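/- \textbf{The Gap Lemma.} Let $n=(4+\epsilon)f$ with integers $n,f\ge 1$ and a real $0<\epsilon\le 1/2$. \emph{The game.} We consider one epoch, which consists of $T$ iterations, of the following game with $n$ processes. Process $i$ has a weight $w_i\in[0,1]$, fixed throughout the epoch. At the beginning of the epoch a set of at most $f$ processes is bad; all others are good. A computationally unbounded, possibly randomized adversary that sees everything that has happened may at any time corrupt a good process (it becomes bad forever), but at most $f$ processes are ever bad. In iteration $t$ the adversary first commits to a direction $\sigma(t)\in\{-1,1\}$. Then a blank $m\times n$ blackboard is filled: the adversary schedules, one at a time and adaptively, which process $i$ writes the next cell of its column $i$ (from top to bottom). A good process writes a fresh uniformly random value in $\{-1,1\}$; a bad one writes a value in $\{-1,1\}$ chosen by the adversary. Once at least $n-f$ columns are full, the adversary may declare the blackboard complete, and it then fixes the view of each process $p$: this is the blackboard except that in at most $f$ columns, chosen by the adversary for each $p$, the last written value is replaced by a blank. Let $X_i(t)$ be the sum of the values in column $i$ of the complete blackboard, replaced by the nearest point of $[-X_{\max},X_{\max}]$ where $X_{\max}=\sqrt{cm\ln n}$, and let $X_i^{(p)}(t)$ be the same quantity in the view of $p$.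 With $\mathrm{sgn}(x)=1$ for $x\ge 0$ and $-1$ otherwise, the game ends in iteration $t$ if $\mathrm{sgn}\big(\sum_i w_iX_i^{(p)}(t)\big)=-\sigma(t)$ for every process $p$ that is good at that time. Put $$\mathrm{dev}(i)=\sum_{t=1}^T(w_iX_i(t))^2,\qquad \mathrm{corr}(i,j)=\sum_{t=1}^T w_iw_jX_i(t)X_j(t),$$ $$\alpha_T=m\big(T+\sqrt{T(c\ln n)^3}\big),\qquad \beta_T=m\sqrt{T(c\ln n)^3}.$$ \emph{Claim.} Let $m=\Theta(n/\epsilon^2)$ and $T=\Theta(n^2\ln^3 n/\epsilon^2)$ with sufficiently large hidden constants (the one for $T$ may depend on $c$). For every sufficiently large constant $c$, all weights $w_i\in[0,1]$, every set of at most $f$ processes that are bad at the beginning, and every strategy of the adversary, the following holds with probability at least $1-n^{-\Omega(c)}$: if all $T$ iterations are completed and the game ends in none of them, then, with $G$ and $B$ the sets of good and bad processes at the end of the epoch, \begin{enumerate} \item every $i\in G$ has $\mathrm{dev}(i)\le w_i^2\alpha_T$; \item all $i,j\in G$ with $i\ne j$ have $\mathrm{corr}(i,j)\le w_iw_j\beta_T$;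 \item if $\sum_{i\in G}(1-w_i)\le\sum_{i\in B}(1-w_i)+\epsilon^2f/8$ and no process was corrupted during the epoch, then $$\sum_{i\in B}\max\{0,\mathrm{dev}(i)-w_i^2\alpha_T\}+\sum_{(i,j)\in B^2,\,i\ne j}\max\{0,\mathrm{corr}(i,j)-w_iw_j\beta_T\}\ \ge\ \frac{\epsilon}{16}f\alpha_T .$$ \end{enumerate} Precisely: there are absolute constants $\kappa,c_0,A>0$ such that for every $c\ge c_0$ there is $D=D(c)>0$ such that for all $A',D'$ there is $n_0=n_0(c,A',D')$ such that, whenever $n\ge n_0$, $A\,n/\epsilon^2\le m\le A'n/\epsilon^2$ and $D\,n^2\ln^3 n/\epsilon^2\le T\le D'n^2\ln^3 n/\epsilon^2$, the probability above is at least $1-n^{-\kappa c}$, uniformly in $\epsilon$, $f$, the weights, the initial bad set and the adversary's strategy. -/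

import Mathlib

open scoped BigOperators

/-! # One epoch of the weighted iterated coin-flipping game

There are `n` processes.  Blackboards are built one after the other; process `i` owns column `i`
of each of them and fills it from the top with at most `m` values in `{-1, 1}`.  An adversary sees
everything, schedules the writes, corrupts processes, chooses the values that bad processes write
and chooses the slightly different views that the processes get.  The value written by a good
process is a fresh fair coin.
-/

noncomputable section

namespace CoinGame

/-- A blackboard under construction, together with the direction to which the adversary committed
itself before the construction began.  `col i` lists the values in column `i` in the order in
which they were written; the cells below them are blank. -/
structure Board (n : ℕ) where
  dir : ℤˣ
  col : Fin n → List ℤˣ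

/-- Process `i` writes `v` in the first blank cell of its column. -/
def Board.write {n : ℕ} (b : Board n) (i : Fin n) (v : ℤˣ) : Board n :=
  { b with col := Function.update b.col i (b.col i ++ [v]) }

/-- The columns all of whose `m` cells are written. -/
def Board.full {n : ℕ} (m : ℕ) (b : Board n) : Finset (Fin n) :=
  Finset.univ.filter fun i => (b.col i).length = m

/-- A completed iteration: the final blackboard, the views of the processes and the set of
processes that were bad at that time.  The view of `p` is the blackboard in which the last value
written in column `i` is blank for every `i ∈ unseen p`. -/
structure Iteration (n : ℕ) where
  board : Board n
  unseen : Fin n → Finset (Fin n)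
  bad : Finset (Fin n)

/-- A position of the game: the bad processes, the iterations of the epoch that are completed
(latest first), and the blackboard under construction, if there is one. -/
structure State (n : ℕ) where
  bad : Finset (Fin n)
  done : List (Iteration n)
  current : Option (Board n)

/-- The moves of the adversary. -/
inductive Move (n : ℕ) where
  /-- commit to the direction of the next iteration and open its (blank) blackboard -/
  | start (dir : ℤˣ)
  /-- let process `i` write its next cell; the value `v` is used only if `i` is bad -/
  | write (i : Fin n) (v : ℤˣ)
  /-- corrupt process `i` -/
  | corrupt (i : Fin n)
  /-- declare the current blackboard complete and fix the views of all processes -/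
  | finish (unseen : Fin n → Finset (Fin n))

/-- The random position after a move; a move against the rules leaves the position as it is.
* An iteration is opened only if none is open and fewer than `T` are completed.
* A column has `m` cells.  A good process writes a fair coin, a bad one what the adversary wants.
* At most `f` processes are ever bad.
* A blackboard is complete only if at least `n - f` columns are full, and the view of each process
  differs from it in at most `f` cells. -/
def step {n : ℕ} (m f T : ℕ) (s : State n) : Move n → PMF (State n)
  | .start dir =>
      match s.current with
      | some _ => PMF.pure s
      | none =>
          if s.done.length < T then PMF.pure { s with current := some ⟨dir, fun _ => []⟩ }
          else PMF.pure s
  | .write i v =>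
      match s.current with
      | none => PMF.pure s
      | some b =>
          if (b.col i).length < m then
            if i ∈ s.bad then PMF.pure { s with current := some (b.write i v) }
            else (PMF.uniformOfFintype ℤˣ).map fun x => { s with current := some (b.write i x) }
          else PMF.pure s
  | .corrupt i =>
      if s.bad.card < f then PMF.pure { s with bad := insert i s.bad } else PMF.pure s
  | .finish unseen =>
      match s.current with
      | none => PMF.pure s
      | some b =>
          if n ≤ (b.full m).card + f ∧ ∀ p, (unseen p).card ≤ f then
            PMF.pure { s with done := ⟨b, unseen, s.bad⟩ :: s.done, current := none }
          else PMF.pure s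

/-- A strategy of the adversary: a (possibly randomized) choice of the next move, given the present
position and the list of all earlier ones. -/
abbrev Adversary (n : ℕ) := State n → List (State n) → PMF (Move n)

/-- The law of the present position and the list of the earlier ones after `N` moves, in an epoch
that begins with the bad processes `B₀`. -/
def play {n : ℕ} (m f T : ℕ) (B₀ : Finset (Fin n)) (adv : Adversary n) :
    ℕ → PMF (State n × List (State n))
  | 0 => PMF.pure (⟨B₀, [], none⟩, [])
  | N + 1 => (play m f T B₀ adv N).bind fun h =>
      (adv h.1 h.2).bind fun a => (step m f T h.1 a).map fun s => (s, h.1 :: h.2)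

/-- `sgn x = 1` if `x ≥ 0`, and `-1` otherwise. -/
def sgn (x : ℝ) : ℤˣ := if 0 ≤ x then 1 else -1

/-- `X_max = √(c m ln n)`. -/
def Xmax (c : ℝ) (n m : ℕ) : ℝ := √(c * m * Real.log n)

/-- The point of `[-M, M]` nearest to `x` (for `M ≥ 0`). -/
def clamp (M x : ℝ) : ℝ := max (-M) (min M x)

def colSum (l : List ℤˣ) : ℝ := (l.map fun v => ((v : ℤ) : ℝ)).sum

/-- `X_i(t)`: the sum of the values in column `i`, rounded into `[-M, M]`. -/
def Iteration.X {n : ℕ} (M : ℝ) (o : Iteration n) (i : Fin n) : ℝ :=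
  clamp M (colSum (o.board.col i))

/-- `X_i^{(p)}(t)`: the same in the view of process `p`. -/
def Iteration.viewX {n : ℕ} (M : ℝ) (o : Iteration n) (p i : Fin n) : ℝ :=
  clamp M (colSum (if i ∈ o.unseen p then (o.board.col i).dropLast else o.board.col i))

/-- The outcome of the coin flip in the view of process `p`. -/
def Iteration.coin {n : ℕ} (w : Fin n → ℝ) (M : ℝ) (o : Iteration n) (p : Fin n) : ℤˣ :=
  sgn (∑ i, w i * o.viewX M p i)

/-- The game ends in an iteration if the coin of every good process is opposite to the direction
of the adversary. -/
def Iteration.Ends {n : ℕ} (w : Fin n → ℝ) (M : ℝ) (o : Iteration n) : Prop :=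
  ∀ p, p ∉ o.bad → o.coin w M p = -o.board.dir

/-- All `T` iterations of the epoch are completed, and the game ended in none of them. -/
def State.Survived {n : ℕ} (T : ℕ) (w : Fin n → ℝ) (M : ℝ) (s : State n) : Prop :=
  s.done.length = T ∧ ∀ o ∈ s.done, ¬ o.Ends w M

/-- `dev(i) = ∑_t (w_i X_i(t))²`. -/
def State.dev {n : ℕ} (w : Fin n → ℝ) (M : ℝ) (s : State n) (i : Fin n) : ℝ :=
  (s.done.map fun o => (w i * o.X M i) ^ 2).sum

/-- `corr(i,j) = ∑_t w_i w_j X_i(t) X_j(t)`. -/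
def State.corr {n : ℕ} (w : Fin n → ℝ) (M : ℝ) (s : State n) (i j : Fin n) : ℝ :=
  (s.done.map fun o => w i * w j * o.X M i * o.X M j).sum

/-- `β_T = m √(T (c ln n)³)`. -/
def betaT (c : ℝ) (n m T : ℕ) : ℝ := m * √(T * (c * Real.log n) ^ 3)

/-- `α_T = m (T + √(T (c ln n)³))`. -/
def alphaT (c : ℝ) (n m T : ℕ) : ℝ := m * (T + √(T * (c * Real.log n) ^ 3))

/-- The weight invariant, for the set `B` of bad processes: the good processes lost at most
`ε² f / 8` more weight than the bad ones. -/
def WeightInvariant {n : ℕ} (ε : ℝ) (f : ℕ) (w : Fin n → ℝ) (B : Finset (Fin n)) : Prop :=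
  ∑ i ∈ Bᶜ, (1 - w i) ≤ ∑ i ∈ B, (1 - w i) + ε ^ 2 * f / 8

/-- The total excess of the scores among the bad processes over their thresholds; the second sum
is over ordered pairs of distinct processes. -/
def State.excess {n : ℕ} (w : Fin n → ℝ) (M α β : ℝ) (s : State n) : ℝ :=
  ∑ i ∈ s.bad, max 0 (s.dev w M i - w i ^ 2 * α) +
    ∑ q ∈ s.bad.offDiag, max 0 (s.corr w M q.1 q.2 - w q.1 * w q.2 * β)

end CoinGame

end

open CoinGame

namespace CoinGame

open scoped ENNReal

/-! Every probabilistic estimate comes from a nonnegative function of the position that no move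
increases in expectation (`IsPotential`). Markov's inequality for it (`IsPotential.prob_le`) then
holds against every adaptive strategy. Functions of a single blackboard with this monotonicity
(`IsBoardPotential`) are assembled over an epoch additively, for a union bound, or exponentially,
for an Azuma bound (`IsBoardPotential.prob_sum_ge_le`).

Good scores. Column sums are stopped once they exceed `Xmax - 1` in absolute value. The stopped sums
are bounded, and off a rare event they are the true sums of the good columns. The square minus the
number of writes, and the product of two different columns, do not increase in expectation, so their
totals over `T` blackboards concentrate below `betaT`.

Excess of the bad. Let `z` be the weighted good sum counted against the adversary's direction. If
the game does not end, the bad sum cancels `z` up to `f`, so its square is at least about `(max z 0)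
^ 2` (`Iteration.sq_bad_sum_ge`). For a symmetric walk of variance `V` the mean of `(max z 0) ^ 2`
is `V / 2`, but an adversary who picks steps of different weights adaptively can destroy the
symmetry. The remedy is Lindeberg's: with a smooth substitute for `(max z 0) ^ 2`, a step of width
`w i` costs only a small error when exchanged for about `w i ^ 2 * r` steps of the common width `1 /
√r` (`smooth_le_avg`). With equal steps the order of writing no longer matters, and `gapPotential`
shows that the mean is nearly `V / 2`.

Balance. A complete blackboard has `V` at least about `m * (n - f - |B| - 2 * ∑ (1 - w i))`, the sum
being over the good. Since `n = (4 + ε) f` and `|B| ≤ f`, the weight invariant gives `V / 2 ≥ m * (∑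
w i + 7 ε f / 16)` up to small errors, now with the sum over the bad. The thresholds absorb only the
first term and lower-order quantities (`State.sum_sq_bad_le`); what remains is excess
(`gap_arithmetic`). -/

/-! ### Expectations under a `PMF` -/

/-- The expectation of a nonnegative function under a `PMF`. -/
noncomputable def expect {α : Type*} (p : PMF α) (g : α → ℝ≥0∞) : ℝ≥0∞ := ∑' a, p a * g a

theorem expect_bind {α β : Type*} (p : PMF α) (q : α → PMF β) (g : β → ℝ≥0∞) :
    expect (p.bind q) g = expect p fun a => expect (q a) g := by
  simp only [expect, PMF.bind_apply, ← ENNReal.tsum_mul_right, ← ENNReal.tsum_mul_left]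
  rw [ENNReal.tsum_comm]
  simp only [mul_assoc]

theorem expect_pure {α : Type*} (a : α) (g : α → ℝ≥0∞) : expect (PMF.pure a) g = g a := by
  classical
  rw [expect, tsum_eq_single a]
  · simp
  · intro b hb
    simp [hb]

theorem expect_map {α β : Type*} (p : PMF α) (h : α → β) (g : β → ℝ≥0∞) :
    expect (p.map h) g = expect p fun a => g (h a) := by
  rw [PMF.map, expect_bind]
  simp only [Function.comp, expect_pure]

theorem expect_mono {α : Type*} (p : PMF α) {g h : α → ℝ≥0∞} (H : ∀ a, g a ≤ h a) :
    expect p g ≤ expect p h :=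
  ENNReal.tsum_le_tsum fun a => mul_le_mul_right (H a) _

theorem expect_const {α : Type*} (p : PMF α) (x : ℝ≥0∞) : expect p (fun _ => x) = x := by
  rw [expect, ENNReal.tsum_mul_right, p.tsum_coe, one_mul]

theorem expect_uniform_units (g : ℤˣ → ℝ) (hg : ∀ v, 0 ≤ g v) :
    expect (PMF.uniformOfFintype ℤˣ) (fun v => ENNReal.ofReal (g v)) =
      ENNReal.ofReal ((g 1 + g (-1)) / 2) := by
  have h2 : (2 : ℝ≥0∞)⁻¹ = ENNReal.ofReal (2⁻¹) := by
    rw [ENNReal.ofReal_inv_of_pos (by norm_num)]; simp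
  rw [expect, tsum_fintype]
  have hu : (Finset.univ : Finset ℤˣ) = {1, -1} := by decide
  rw [hu, Finset.sum_pair (by decide)]
  simp only [PMF.uniformOfFintype_apply, Fintype.card_units_int, Nat.cast_ofNat]
  rw [h2, ← ENNReal.ofReal_mul (by norm_num), ← ENNReal.ofReal_mul (by norm_num),
    ← ENNReal.ofReal_add (by have := hg 1; positivity) (by have := hg (-1); positivity)]
  congr 1
  ring

/-- A Markov inequality. -/
theorem toOuterMeasure_le_expect {α : Type*} (p : PMF α) (S : Set α) (g : α → ℝ≥0∞)
    (hg : ∀ a ∈ S, 1 ≤ g a) : p.toOuterMeasure S ≤ expect p g := by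
  classical
  rw [PMF.toOuterMeasure_apply, expect]
  refine ENNReal.tsum_le_tsum fun a => ?_
  by_cases ha : a ∈ S
  · rw [Set.indicator_of_mem ha]
    exact le_mul_of_one_le_right (by positivity) (hg a ha)
  · rw [Set.indicator_of_notMem ha]
    positivity

/-! ### Supermartingales of the game -/

variable {n : ℕ}

/-- Nonnegative functions of the position that no move can increase in expectation. -/
structure IsPotential (m T : ℕ) (F : State n → ℝ) : Prop where
  nonneg : ∀ s, 0 ≤ F s
  start : ∀ B D dir, D.length < T → F ⟨B, D, some ⟨dir, fun _ => []⟩⟩ ≤ F ⟨B, D, none⟩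
  writeBad : ∀ B D (b : Board n) i v, i ∈ B → (b.col i).length < m →
    F ⟨B, D, some (b.write i v)⟩ ≤ F ⟨B, D, some b⟩
  writeGood : ∀ B D (b : Board n) i, i ∉ B → (b.col i).length < m →
    F ⟨B, D, some (b.write i 1)⟩ + F ⟨B, D, some (b.write i (-1))⟩ ≤ 2 * F ⟨B, D, some b⟩
  corrupt : ∀ B D cur i, F ⟨insert i B, D, cur⟩ ≤ F ⟨B, D, cur⟩
  finish : ∀ B D (b : Board n) unseen, F ⟨B, ⟨b, unseen, B⟩ :: D, none⟩ ≤ F ⟨B, D, some b⟩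

theorem IsPotential.step_le {m f T : ℕ} {F : State n → ℝ} (hF : IsPotential m T F)
    (s : State n) (a : Move n) :
    expect (step m f T s a) (fun s => ENNReal.ofReal (F s)) ≤ ENNReal.ofReal (F s) := by
  obtain ⟨B, D, cur⟩ := s
  cases a with
  | start dir =>
    cases cur with
    | some b => simp [step, expect_pure]
    | none =>
      simp only [step]
      split_ifs with h
      · rw [expect_pure]
        exact ENNReal.ofReal_le_ofReal (hF.start _ _ _ h)
      · rw [expect_pure]
  | write i v =>
    cases cur with
    | none => simp [step, expect_pure]
    | some b =>
      simp only [step]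
      split_ifs with h hi
      · rw [expect_pure]
        exact ENNReal.ofReal_le_ofReal (hF.writeBad _ _ _ _ _ hi h)
      · rw [expect_map, expect_uniform_units (fun x => F ⟨B, D, some (b.write i x)⟩)
          (fun _ => hF.nonneg _)]
        refine ENNReal.ofReal_le_ofReal ?_
        linarith [hF.writeGood B D b i hi h]
      · rw [expect_pure]
  | corrupt i =>
    simp only [step]
    split_ifs with h
    · rw [expect_pure]
      exact ENNReal.ofReal_le_ofReal (hF.corrupt _ _ _ _)
    · rw [expect_pure]
  | finish unseen =>
    cases cur with
    | none => simp [step, expect_pure]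
    | some b =>
      simp only [step]
      split_ifs with h
      · rw [expect_pure]
        exact ENNReal.ofReal_le_ofReal (hF.finish _ _ _ _)
      · rw [expect_pure]

/-- The one-step bound holds for each individual move, so averaging over a randomized choice that
depends on the whole history preserves it. -/
theorem IsPotential.expect_play_le {m f T : ℕ} {F : State n → ℝ} (hF : IsPotential m T F)
    (B₀ : Finset (Fin n)) (adv : Adversary n) (N : ℕ) :
    expect (play m f T B₀ adv N) (fun h => ENNReal.ofReal (F h.1)) ≤
      ENNReal.ofReal (F ⟨B₀, [], none⟩) := by
  induction N with
  | zero => simp [play, expect_pure]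
  | succ N ih =>
    rw [play, expect_bind]
    refine le_trans (expect_mono _ fun h => ?_) ih
    rw [expect_bind]
    refine le_trans (expect_mono _ fun a => ?_) (expect_const (adv h.1 h.2) _).le
    rw [expect_map]
    exact hF.step_le _ _

/-- The probability of a set of positions where a potential is at least `δ`. -/
theorem IsPotential.prob_le {m f T : ℕ} {F : State n → ℝ} (hF : IsPotential m T F)
    (B₀ : Finset (Fin n)) (adv : Adversary n) (N : ℕ) (S : Set (State n × List (State n)))
    {δ : ℝ} (hδ : 0 < δ) (hS : ∀ h ∈ S, δ ≤ F h.1) :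
    (play m f T B₀ adv N).toOuterMeasure S ≤ ENNReal.ofReal (F ⟨B₀, [], none⟩ / δ) := by
  have hF' : IsPotential m T fun s => F s / δ := by
    refine ⟨fun s => div_nonneg (hF.nonneg s) hδ.le, fun B D dir h => ?_, fun B D b i v h1 h2 => ?_,
      fun B D b i h1 h2 => ?_, fun B D cur i => ?_, fun B D b u => ?_⟩
    · exact div_le_div_of_nonneg_right (hF.start _ _ _ h) hδ.le
    · exact div_le_div_of_nonneg_right (hF.writeBad _ _ _ _ _ h1 h2) hδ.le
    · rw [← add_div, ← mul_div_assoc]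
      exact div_le_div_of_nonneg_right (hF.writeGood _ _ _ _ h1 h2) hδ.le
    · exact div_le_div_of_nonneg_right (hF.corrupt _ _ _ _) hδ.le
    · exact div_le_div_of_nonneg_right (hF.finish _ _ _ _) hδ.le
  refine le_trans (toOuterMeasure_le_expect _ _ _ fun h hh => ?_) (hF'.expect_play_le B₀ adv N)
  rw [ENNReal.one_le_ofReal, one_le_div hδ]
  exact hS h hh

/-! ### Invariants of reachable positions -/

/-- What the rules of the game guarantee about the positions that can be reached. -/
structure Legal (m f T : ℕ) (B₀ : Finset (Fin n)) (s : State n) : Prop where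
  bad : B₀ ⊆ s.bad
  done_bad : ∀ o ∈ s.done, B₀ ⊆ o.bad ∧ o.bad ⊆ s.bad
  done_length : ∀ o ∈ s.done, ∀ i, (o.board.col i).length ≤ m
  done_full : ∀ o ∈ s.done, n ≤ (o.board.full m).card + f
  done_unseen : ∀ o ∈ s.done, ∀ p, (o.unseen p).card ≤ f
  current_length : ∀ b, s.current = some b → ∀ i, (b.col i).length ≤ m
  current_lt : ∀ b, s.current = some b → s.done.length < T

theorem Board.write_col_self (b : Board n) (i : Fin n) (v : ℤˣ) :
    (b.write i v).col i = b.col i ++ [v] := by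
  simp [Board.write]

theorem Board.write_col_of_ne (b : Board n) {i j : Fin n} (h : j ≠ i) (v : ℤˣ) :
    (b.write i v).col j = b.col j := by
  simp [Board.write, h]

theorem Legal.write {m f T : ℕ} {B₀ B : Finset (Fin n)} {D : List (Iteration n)} {b : Board n}
    (h : Legal m f T B₀ ⟨B, D, some b⟩) (i : Fin n) (v : ℤˣ) (hi : (b.col i).length < m) :
    Legal m f T B₀ ⟨B, D, some (b.write i v)⟩ := by
  refine ⟨h.bad, h.done_bad, h.done_length, h.done_full, h.done_unseen, fun b' hb' j => ?_,
    fun b' hb' => h.current_lt b rfl⟩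
  obtain rfl : b.write i v = b' := by simpa using hb'
  by_cases hj : j = i
  · subst hj
    rw [Board.write_col_self]
    simp
    omega
  · rw [Board.write_col_of_ne b hj]
    exact h.current_length b rfl j

theorem Legal.step {m f T : ℕ} {B₀ : Finset (Fin n)} {s s' : State n} {a : Move n}
    (h : Legal m f T B₀ s) (hs' : s' ∈ (step m f T s a).support) : Legal m f T B₀ s' := by
  obtain ⟨B, D, cur⟩ := s
  cases a with
  | start dir =>
    cases cur with
    | some b =>
      simp only [CoinGame.step, PMF.support_pure, Set.mem_singleton_iff] at hs'
      exact hs' ▸ h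
    | none =>
      simp only [CoinGame.step] at hs'
      split_ifs at hs' with hT <;> rw [PMF.support_pure, Set.mem_singleton_iff] at hs' <;>
        subst hs'
      · refine ⟨h.bad, h.done_bad, h.done_length, h.done_full, h.done_unseen, fun b hb i => ?_,
          fun b hb => hT⟩
        obtain rfl := Option.some.inj hb
        simp
      · exact h
  | write i v =>
    cases cur with
    | none =>
      simp only [CoinGame.step, PMF.support_pure, Set.mem_singleton_iff] at hs'
      exact hs' ▸ h
    | some b =>
      simp only [CoinGame.step] at hs'
      split_ifs at hs' with hl hi
      · rw [PMF.support_pure, Set.mem_singleton_iff] at hs'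
        exact hs' ▸ h.write i v hl
      · rw [PMF.mem_support_map_iff] at hs'
        obtain ⟨x, -, rfl⟩ := hs'
        exact h.write i x hl
      · rw [PMF.support_pure, Set.mem_singleton_iff] at hs'
        exact hs' ▸ h
  | corrupt i =>
    simp only [CoinGame.step] at hs'
    split_ifs at hs' with hT <;> rw [PMF.support_pure, Set.mem_singleton_iff] at hs' <;>
      subst hs'
    · exact ⟨h.bad.trans (Finset.subset_insert _ _), fun o ho => ⟨(h.done_bad o ho).1,
        (h.done_bad o ho).2.trans (Finset.subset_insert _ _)⟩, h.done_length, h.done_full,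
        h.done_unseen, h.current_length, h.current_lt⟩
    · exact h
  | finish unseen =>
    cases cur with
    | none =>
      simp only [CoinGame.step, PMF.support_pure, Set.mem_singleton_iff] at hs'
      exact hs' ▸ h
    | some b =>
      simp only [CoinGame.step] at hs'
      split_ifs at hs' with hf <;> rw [PMF.support_pure, Set.mem_singleton_iff] at hs' <;>
        subst hs'
      · refine ⟨h.bad, List.forall_mem_cons.2 ⟨⟨h.bad, subset_rfl⟩, h.done_bad⟩,
          List.forall_mem_cons.2 ⟨h.current_length b rfl, h.done_length⟩,
          List.forall_mem_cons.2 ⟨hf.1, h.done_full⟩,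
          List.forall_mem_cons.2 ⟨hf.2, h.done_unseen⟩, ?_, ?_⟩ <;>
        · intro b hb
          cases hb
      · exact h

theorem legal_of_mem_support_play {m f T : ℕ} {B₀ : Finset (Fin n)} {adv : Adversary n} {N : ℕ}
    {h : State n × List (State n)} (hh : h ∈ (play m f T B₀ adv N).support) :
    Legal m f T B₀ h.1 := by
  induction N generalizing h with
  | zero =>
    rw [play, PMF.support_pure, Set.mem_singleton_iff] at hh
    subst hh
    constructor <;> simp
  | succ N ih =>
    rw [play, PMF.mem_support_bind_iff] at hh
    obtain ⟨g, hg, hh⟩ := hh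
    rw [PMF.mem_support_bind_iff] at hh
    obtain ⟨a, -, hh⟩ := hh
    rw [PMF.mem_support_map_iff] at hh
    obtain ⟨s, hs, rfl⟩ := hh
    exact (ih hg).step hs

/-! ### From one blackboard to an epoch: union bound and Azuma--Hoeffding -/

/-- Functions of the bad set and the blackboard under construction that no move can increase in
expectation. -/
structure IsBoardPotential (m : ℕ) (y : Finset (Fin n) → Board n → ℝ) : Prop where
  writeBad : ∀ B (b : Board n) i v, i ∈ B → (b.col i).length < m → y B (b.write i v) ≤ y B b
  writeGood : ∀ B (b : Board n) i, i ∉ B → (b.col i).length < m →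
    y B (b.write i 1) + y B (b.write i (-1)) ≤ 2 * y B b
  corrupt : ∀ B (b : Board n) i, y (insert i B) b ≤ y B b

/-- A union bound over the iterations. -/
theorem IsBoardPotential.prob_exists_le {m f T : ℕ} {y : Finset (Fin n) → Board n → ℝ}
    (hy : IsBoardPotential m y) (hy0 : ∀ B b, 0 ≤ y B b) {q : ℝ}
    (hblank : ∀ B dir, y B ⟨dir, fun _ => []⟩ ≤ q) (hq : 0 ≤ q)
    (B₀ : Finset (Fin n)) (adv : Adversary n) (N : ℕ) :
    (play m f T B₀ adv N).toOuterMeasure {h | ∃ o ∈ h.1.done, 1 ≤ y o.bad o.board} ≤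
      ENNReal.ofReal (T * q) := by
  let cur : Finset (Fin n) → Option (Board n) → ℝ := fun B c => c.elim 0 (y B)
  -- Blackboards not yet opened. Each holds a budget `q`, which is exchanged for the potential of
  -- the blank board on opening.
  let left : State n → ℕ := fun s => T - s.done.length - s.current.elim 0 (fun _ => 1)
  have hcur : ∀ B c, 0 ≤ cur B c := fun B c => by
    cases c with
    | none => simp [cur]
    | some b => exact hy0 B b
  have hsum : ∀ D : List (Iteration n), 0 ≤ (D.map fun o => y o.bad o.board).sum := fun D =>
    List.sum_nonneg (by simp only [List.mem_map]; rintro _ ⟨o, -, rfl⟩; exact hy0 _ _)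
  let F : State n → ℝ := fun s =>
    (s.done.map fun o => y o.bad o.board).sum + cur s.bad s.current + left s * q
  have hF : IsPotential m T F := by
    refine ⟨fun s => ?_, fun B D dir h => ?_, fun B D b i v h1 h2 => ?_,
      fun B D b i h1 h2 => ?_, fun B D c i => ?_, fun B D b u => ?_⟩
    · have := hsum s.done
      have := hcur s.bad s.current
      positivity
    · have h1 : ((T - D.length : ℕ) : ℝ) = ((T - D.length - 1 : ℕ) : ℝ) + 1 := by
        norm_cast; omega
      simp only [F, left, cur, Option.elim, Nat.sub_zero, h1]
      linarith [hblank B dir]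
    · simp only [F, left, cur, Option.elim]
      linarith [hy.writeBad B b i v h1 h2]
    · simp only [F, left, cur, Option.elim]
      linarith [hy.writeGood B b i h1 h2]
    · cases c with
      | none => simp [F, left, cur]
      | some b =>
        simp only [F, left, cur, Option.elim]
        linarith [hy.corrupt B b i]
    · simp only [F, left, cur, Option.elim, List.map_cons, List.sum_cons, List.length_cons,
        Nat.sub_sub]
      linarith
  refine le_trans (hF.prob_le B₀ adv N _ one_pos ?_) (le_of_eq ?_)
  · rintro ⟨s, l⟩ ⟨o, ho, h1⟩
    have h2 : y o.bad o.board ≤ (s.done.map fun o => y o.bad o.board).sum :=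
      List.single_le_sum (by simp only [List.mem_map]; rintro _ ⟨o, -, rfl⟩; exact hy0 _ _) _
        (List.mem_map.2 ⟨o, ho, rfl⟩)
    have := hcur s.bad s.current
    have : 0 ≤ left s * q := by positivity
    simp only [F]
    linarith
  · simp [F, left, cur]

/-- The chord of `exp (l x)` over `[-M, M]`. -/
theorem exp_mul_le_chord {l M x : ℝ} (hM : 0 < M) (h1 : -M ≤ x) (h2 : x ≤ M) :
    Real.exp (l * x) ≤ Real.cosh (l * M) + x / M * Real.sinh (l * M) := by
  have ha : 0 ≤ (M + x) / (2 * M) := div_nonneg (by linarith) (by linarith)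
  have hb : 0 ≤ (M - x) / (2 * M) := div_nonneg (by linarith) (by linarith)
  have hab : (M + x) / (2 * M) + (M - x) / (2 * M) = 1 := by field_simp; ring
  have h := convexOn_exp.2 (Set.mem_univ (l * M)) (Set.mem_univ (-(l * M))) ha hb hab
  simp only [smul_eq_mul] at h
  have e1 : (M + x) / (2 * M) * (l * M) + (M - x) / (2 * M) * -(l * M) = l * x := by
    field_simp; ring
  rw [e1] at h
  refine h.trans (le_of_eq ?_)
  rw [Real.cosh_eq, Real.sinh_eq]
  field_simp
  ring

/-- The Azuma--Hoeffding inequality for the game. -/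
theorem IsBoardPotential.prob_sum_ge_le {m f T : ℕ} {y : Finset (Fin n) → Board n → ℝ}
    (hy : IsBoardPotential m y) {M : ℝ} (hM : 0 < M) (hlo : ∀ B b, -M ≤ y B b)
    (hhi : ∀ B b, y B b ≤ M) (hblank : ∀ B dir, y B ⟨dir, fun _ => []⟩ ≤ 0)
    (B₀ : Finset (Fin n)) (adv : Adversary n) (N : ℕ) {a : ℝ} (ha : 0 ≤ a) (hT : 0 < T) :
    (play m f T B₀ adv N).toOuterMeasure {h | h.1.done.length = T ∧ h.1.current = none ∧
        a ≤ (h.1.done.map fun o => y o.bad o.board).sum} ≤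
      ENNReal.ofReal (Real.exp (-(a ^ 2 / (2 * T * M ^ 2)))) := by
  -- The parameter `l` minimizes `T * (l * M) ^ 2 / 2 - l * a`.
  have hT' : (0 : ℝ) < T := by exact_mod_cast hT
  obtain ⟨l, hl⟩ : ∃ l : ℝ, l = a / (T * M ^ 2) := ⟨_, rfl⟩
  have hl0 : 0 ≤ l := by rw [hl]; positivity
  have hS : 0 ≤ Real.sinh (l * M) / M :=
    div_nonneg (Real.sinh_nonneg_iff.2 (by positivity)) hM.le
  -- While a board is open, the chord replaces `exp (l * y)`. It is affine and nondecreasing in `y`,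
  -- so it inherits the monotonicity of `y` in expectation; on a blank board it is at most `cosh (l
  -- * M)`, and on completion it dominates the exponential.
  let cur : Finset (Fin n) → Option (Board n) → ℝ := fun B c =>
    c.elim 1 (fun b => Real.cosh (l * M) + Real.sinh (l * M) / M * y B b)
  let left : State n → ℕ := fun s => T - s.done.length - s.current.elim 0 (fun _ => 1)
  have hcur : ∀ B c, 0 ≤ cur B c := fun B c => by
    cases c with
    | none => simp [cur]
    | some b =>
      have h := exp_mul_le_chord (l := l) hM (hlo B b) (hhi B b)
      have e : y B b / M * Real.sinh (l * M) = Real.sinh (l * M) / M * y B b := by ring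
      rw [e] at h
      exact (Real.exp_pos _).le.trans h
  have hc := Real.cosh_pos (l * M)
  let S : List (Iteration n) → ℝ := fun D => (D.map fun o => y o.bad o.board).sum
  let F : State n → ℝ := fun s =>
    (Real.exp (l * S s.done) * Real.cosh (l * M) ^ left s) * cur s.bad s.current
  have hpos : ∀ s, 0 ≤ Real.exp (l * S s.done) * Real.cosh (l * M) ^ left s := fun s => by
    positivity
  have hF : IsPotential m T F := by
    refine ⟨fun s => mul_nonneg (hpos s) (hcur _ _), fun B D dir h => ?_,
      fun B D b i v h1 h2 => ?_, fun B D b i h1 h2 => ?_, fun B D c i => ?_, fun B D b u => ?_⟩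
    · have h1 : T - D.length = (T - D.length - 1) + 1 := by omega
      simp only [F, left, cur, Option.elim, Nat.sub_zero]
      conv_rhs => rw [h1, pow_succ]
      rw [mul_one, ← mul_assoc]
      refine mul_le_mul_of_nonneg_left ?_ (by positivity)
      nlinarith [hblank B dir]
    · refine mul_le_mul_of_nonneg_left ?_ (hpos ⟨B, D, some b⟩)
      simp only [cur, Option.elim]
      nlinarith [hy.writeBad B b i v h1 h2]
    · have e : ∀ x y z w : ℝ, y + z ≤ 2 * w → 0 ≤ x → x * y + x * z ≤ 2 * (x * w) := by
        intro x y z w h hx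
        nlinarith
      refine e _ _ _ _ ?_ (hpos ⟨B, D, some b⟩)
      simp only [cur, Option.elim]
      nlinarith [hy.writeGood B b i h1 h2]
    · refine mul_le_mul_of_nonneg_left ?_ (hpos ⟨B, D, c⟩)
      cases c with
      | none => simp [cur]
      | some b =>
        simp only [cur, Option.elim]
        nlinarith [hy.corrupt B b i]
    · simp only [F, S, left, cur, Option.elim, List.map_cons, List.sum_cons, List.length_cons,
        Nat.sub_sub, mul_one, mul_add, Real.exp_add]
      have h := exp_mul_le_chord (l := l) hM (hlo B b) (hhi B b)
      have e : y B b / M * Real.sinh (l * M) = Real.sinh (l * M) / M * y B b := by ring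
      rw [e] at h
      have := mul_le_mul_of_nonneg_left h (hpos ⟨B, D, some b⟩)
      simp only [S, left, Option.elim, Nat.sub_sub] at this
      linarith
  refine le_trans (hF.prob_le B₀ adv N _ (Real.exp_pos (l * a)) ?_)
    (ENNReal.ofReal_le_ofReal ?_)
  · rintro ⟨⟨B, D, c⟩, t⟩ ⟨h1, h2, h3⟩
    simp only at h1 h2 h3
    subst h2
    simp only [F, left, cur, S, Option.elim, h1, Nat.sub_self, pow_zero, mul_one]
    exact Real.exp_le_exp.2 (mul_le_mul_of_nonneg_left h3 hl0)
  · simp only [F, left, cur, S, Option.elim, List.map_nil, List.sum_nil, mul_zero, Real.exp_zero,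
      List.length_nil, Nat.sub_zero, mul_one, one_mul]
    rw [div_le_iff₀ (Real.exp_pos _), ← Real.exp_add]
    calc Real.cosh (l * M) ^ T ≤ Real.exp ((l * M) ^ 2 / 2) ^ T :=
          pow_le_pow_left₀ hc.le (Real.cosh_le_exp_half_sq _) _
      _ = Real.exp (T * ((l * M) ^ 2 / 2)) := by rw [← Real.exp_nat_mul]
      _ = _ := by
          congr 1
          rw [hl]
          field_simp
          ring

/-! ### Lindeberg replacement and a smooth squared positive part -/

/-- The operator of one step of the simple random walk of step width `η`. -/
noncomputable def avg (η : ℝ) (g : ℝ → ℝ) (z : ℝ) : ℝ := (g (z + η) + g (z - η)) / 2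

theorem avg_iterate_mono {η : ℝ} {g h : ℝ → ℝ} (H : ∀ z, g z ≤ h z) (k : ℕ) (z : ℝ) :
    (avg η)^[k] g z ≤ (avg η)^[k] h z := by
  induction k generalizing z with
  | zero => exact H z
  | succ k ih =>
    rw [Function.iterate_succ_apply', Function.iterate_succ_apply', avg, avg]
    linarith [ih (z + η), ih (z - η)]

/-- These are the second and fourth moments of a walk of `k` steps. They let a cubic remainder be
controlled after many fine steps, where bounding each step separately is avoided. -/
theorem avg_iterate_quartic (η z₀ c₀ c₁ c₂ c₄ : ℝ) (k : ℕ) (z : ℝ) :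
    (avg η)^[k] (fun x => c₀ + c₁ * (x - z₀) + c₂ * (x - z₀) ^ 2 + c₄ * (x - z₀) ^ 4) z =
      c₀ + c₁ * (z - z₀) + c₂ * ((z - z₀) ^ 2 + k * η ^ 2) +
        c₄ * ((z - z₀) ^ 4 + 6 * k * η ^ 2 * (z - z₀) ^ 2 + (3 * k ^ 2 - 2 * k) * η ^ 4) := by
  induction k generalizing z with
  | zero => simp
  | succ k ih =>
    rw [Function.iterate_succ_apply', avg, ih, ih]
    push_cast
    ring

/-- Convex functions with a cubic remainder in their Taylor expansions of second order. -/
def HasCubicRemainder (L : ℝ) (g : ℝ → ℝ) : Prop :=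
  ∃ g₁ g₂ : ℝ → ℝ, (∀ z, 0 ≤ g₂ z) ∧
    ∀ z y, |g (z + y) - g z - g₁ z * y - g₂ z * y ^ 2| ≤ L * |y| ^ 3

theorem HasCubicRemainder.avg {L : ℝ} {g : ℝ → ℝ} (hg : HasCubicRemainder L g) (η : ℝ) :
    HasCubicRemainder L (avg η g) := by
  obtain ⟨g₁, g₂, h0, h⟩ := hg
  refine ⟨CoinGame.avg η g₁, CoinGame.avg η g₂, fun z => ?_, fun z y => ?_⟩
  · unfold CoinGame.avg
    linarith [h0 (z + η), h0 (z - η)]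
  · have h1 := abs_le.1 (h (z + η) y)
    have h2 := abs_le.1 (h (z - η) y)
    have e1 : z + η + y = z + y + η := by ring
    have e2 : z - η + y = z + y - η := by ring
    rw [e1] at h1
    rw [e2] at h2
    unfold CoinGame.avg
    rw [abs_le]
    constructor <;> linarith [h1.1, h1.2, h2.1, h2.2]

theorem HasCubicRemainder.avg_iterate {L : ℝ} {g : ℝ → ℝ} (hg : HasCubicRemainder L g) (η : ℝ)
    (k : ℕ) : HasCubicRemainder L ((CoinGame.avg η)^[k] g) := by
  induction k with
  | zero => exact hg
  | succ k ih =>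
    rw [Function.iterate_succ_apply']
    exact ih.avg η

/-- Lindeberg replacement of a step of width `w` by at most `w² / η²` steps of width `η`. -/
theorem HasCubicRemainder.avg_iterate_le {L : ℝ} {g : ℝ → ℝ} (hg : HasCubicRemainder L g)
    (hL : 0 ≤ L) {η w : ℝ} {k : ℕ} (hw0 : 0 ≤ w) (hw1 : w ≤ 1) (hk : k * η ^ 2 ≤ w ^ 2) (z : ℝ) :
    (CoinGame.avg η)^[k] g z ≤ CoinGame.avg w g z + 3 * L := by
  obtain ⟨g₁, g₂, h0, h⟩ := hg
  have hup : ∀ x, g x ≤ g z + g₁ z * (x - z) + (g₂ z + L / 2) * (x - z) ^ 2 +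
      L / 2 * (x - z) ^ 4 := by
    intro x
    have h1 := (abs_le.1 (h z (x - z))).2
    rw [add_sub_cancel] at h1
    -- The odd absolute moment has no closed form along the walk, so it is traded for even ones by
    -- the inequality of the means.
    have h2 : |x - z| ^ 3 ≤ ((x - z) ^ 2 + (x - z) ^ 4) / 2 := by
      rw [← sq_abs (x - z), show (x - z) ^ 4 = |x - z| ^ 4 from (Even.pow_abs (by decide) _).symm]
      nlinarith [mul_nonneg (sq_nonneg |x - z|) (sq_nonneg (|x - z| - 1))]
    nlinarith
  have hA := avg_iterate_mono (η := η) hup k z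
  rw [avg_iterate_quartic] at hA
  have hw2 : w ^ 2 ≤ 1 := by nlinarith
  have hkη : 0 ≤ k * η ^ 2 := by positivity
  have h3 : (3 * (k : ℝ) ^ 2 - 2 * k) * η ^ 4 ≤ 3 := by
    have e : (3 * (k : ℝ) ^ 2 - 2 * k) * η ^ 4 = 3 * (k * η ^ 2) ^ 2 - 2 * k * η ^ 4 := by ring
    rw [e]
    have : 0 ≤ 2 * (k : ℝ) * η ^ 4 := by positivity
    nlinarith
  have h4 := (abs_le.1 (h z w)).1
  have h5 := (abs_le.1 (h z (-w))).1
  rw [abs_neg] at h5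
  rw [abs_of_nonneg hw0] at h4 h5
  have hw3 : L * w ^ 3 ≤ L := mul_le_of_le_one_right hL (pow_le_one₀ hw0 hw1)
  have e2 : z + -w = z - w := by ring
  rw [e2] at h5
  -- Convexity is what permits the fine steps to have less variance than the coarse one. The errors
  -- add up to `L / 2 + 3 * L / 2 + L`.
  have h6 : g₂ z * (k * η ^ 2) ≤ g₂ z * w ^ 2 := mul_le_mul_of_nonneg_left hk (h0 z)
  have h7 : L / 2 * (k * η ^ 2) ≤ L / 2 := mul_le_of_le_one_right (by linarith) (hk.trans hw2)
  have h8 : L / 2 * ((3 * (k : ℝ) ^ 2 - 2 * k) * η ^ 4) ≤ L / 2 * 3 :=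
    mul_le_mul_of_nonneg_left h3 (by linarith)
  have h9 : CoinGame.avg w g z = (g (z + w) + g (z - w)) / 2 := rfl
  rw [h9]
  simp only [sub_self] at hA
  nlinarith

/-- A cubic spline close to `x ↦ (max x 0)²`. -/
noncomputable def spline (a z : ℝ) : ℝ := ((max (z + a) 0) ^ 3 - (max (z - a) 0) ^ 3) / (6 * a)

theorem abs_posPart_cube_remainder_le (z y : ℝ) :
    |(max (z + y) 0) ^ 3 - (max z 0) ^ 3 - 3 * (max z 0) ^ 2 * y - 3 * max z 0 * y ^ 2| ≤
      |y| ^ 3 := by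
  rcases le_total z 0 with hz | hz
  · rw [max_eq_right hz]
    rcases le_total (z + y) 0 with h | h
    · rw [max_eq_right h]
      simp
    · rw [max_eq_left h]
      have hy : 0 ≤ y := by linarith
      have e : (z + y) ^ 3 - 0 ^ 3 - 3 * 0 ^ 2 * y - 3 * 0 * y ^ 2 = (z + y) ^ 3 := by ring
      rw [abs_of_nonneg hy, e, abs_of_nonneg (pow_nonneg h 3)]
      exact pow_le_pow_left₀ h (by linarith) 3
  · rw [max_eq_left hz]
    rcases le_total (z + y) 0 with h | h
    · rw [max_eq_right h]
      have hy : y ≤ 0 := by linarith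
      rw [abs_of_nonpos hy]
      have h1 : (-(z + y)) ^ 3 ≤ (-y) ^ 3 := pow_le_pow_left₀ (by linarith) (by linarith) 3
      have h2 : 0 ≤ (-(z + y)) ^ 3 := pow_nonneg (by linarith) 3
      rw [abs_le]
      constructor <;> nlinarith
    · rw [max_eq_left h]
      have e : (z + y) ^ 3 - z ^ 3 - 3 * z ^ 2 * y - 3 * z * y ^ 2 = y ^ 3 := by ring
      rw [e, abs_pow]

theorem hasCubicRemainder_spline {a : ℝ} (ha : 0 < a) :
    HasCubicRemainder (1 / (3 * a)) (spline a) := by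
  refine ⟨fun z => (3 * (max (z + a) 0) ^ 2 - 3 * (max (z - a) 0) ^ 2) / (6 * a),
    fun z => (3 * max (z + a) 0 - 3 * max (z - a) 0) / (6 * a), fun z => ?_, fun z y => ?_⟩
  · have : max (z - a) 0 ≤ max (z + a) 0 := max_le_max (by linarith) le_rfl
    exact div_nonneg (by linarith) (by linarith)
  · have h1 := abs_le.1 (abs_posPart_cube_remainder_le (z + a) y)
    have h2 := abs_le.1 (abs_posPart_cube_remainder_le (z - a) y)
    have e1 : z + y + a = z + a + y := by ring
    have e2 : z + y - a = z - a + y := by ring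
    have e3 : 1 / (3 * a) * |y| ^ 3 = 2 * |y| ^ 3 / (6 * a) := by field_simp; ring
    simp only [spline]
    rw [e1, e2, e3, ← sub_div, div_mul_eq_mul_div, div_mul_eq_mul_div, ← sub_div, ← sub_div,
      abs_div, abs_of_pos (show 0 < 6 * a by linarith)]
    refine div_le_div_of_nonneg_right ?_ (by linarith)
    rw [abs_le]
    constructor <;> linarith [h1.1, h1.2, h2.1, h2.2]

theorem spline_nonneg {a : ℝ} (ha : 0 < a) (z : ℝ) : 0 ≤ spline a z := by
  have h : (max (z - a) 0) ^ 3 ≤ (max (z + a) 0) ^ 3 :=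
    pow_le_pow_left₀ (le_max_right _ _) (max_le_max (by linarith) le_rfl) 3
  exact div_nonneg (by linarith) (by linarith)

/-- The spline is the mean of `(max t 0) ^ 2` over `[z - a, z + a]`. The squares of the positive and
negative parts of `t` add up to `t ^ 2`, whose mean over that interval is `z ^ 2 + a ^ 2 / 3`. -/
theorem spline_add_spline_neg {a : ℝ} (ha : 0 < a) (z : ℝ) :
    spline a z + spline a (-z) = z ^ 2 + a ^ 2 / 3 := by
  unfold spline
  rw [← add_div, div_eq_iff (by positivity)]
  rcases le_total z a with h1 | h1
  · rcases le_total (-a) z with h2 | h2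
    · rw [max_eq_left (by linarith : 0 ≤ z + a), max_eq_right (by linarith : z - a ≤ 0),
        max_eq_left (by linarith : 0 ≤ -z + a), max_eq_right (by linarith : -z - a ≤ 0)]
      ring
    · rw [max_eq_right (by linarith : z + a ≤ 0), max_eq_right (by linarith : z - a ≤ 0),
        max_eq_left (by linarith : 0 ≤ -z + a), max_eq_left (by linarith : 0 ≤ -z - a)]
      ring
  · rw [max_eq_left (by linarith : 0 ≤ z + a), max_eq_left (by linarith : 0 ≤ z - a),
      max_eq_right (by linarith : -z + a ≤ 0), max_eq_right (by linarith : -z - a ≤ 0)]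
    ring

theorem spline_le {a : ℝ} (ha : 0 < a) (z : ℝ) : spline a z ≤ (max z 0) ^ 2 + a ^ 2 / 3 := by
  rcases le_total 0 z with h | h
  · rw [max_eq_left h]
    linarith [spline_add_spline_neg ha z, spline_nonneg ha (-z)]
  · rw [max_eq_right h]
    have h1 : (max (z + a) 0) ^ 3 ≤ a ^ 3 :=
      pow_le_pow_left₀ (le_max_right _ _) (max_le (by linarith) ha.le) 3
    have h2 : 0 ≤ (max (z - a) 0) ^ 3 := pow_nonneg (le_max_right _ _) 3
    unfold spline
    rw [div_le_iff₀ (by linarith)]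
    have : 0 < a ^ 3 := by positivity
    nlinarith

/-- The expected value of `spline a` after `k` further steps of width `η`. -/
noncomputable def smooth (η a : ℝ) (k : ℕ) : ℝ → ℝ := (avg η)^[k] (spline a)

theorem smooth_nonneg {a : ℝ} (ha : 0 < a) (η : ℝ) (k : ℕ) (z : ℝ) : 0 ≤ smooth η a k z := by
  induction k generalizing z with
  | zero => exact spline_nonneg ha z
  | succ k ih =>
    rw [smooth, Function.iterate_succ_apply', avg]
    have h1 := ih (z + η)
    have h2 := ih (z - η)
    rw [smooth] at h1 h2
    linarith

theorem smooth_add_smooth_neg {a : ℝ} (ha : 0 < a) (η : ℝ) (k : ℕ) (z : ℝ) :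
    smooth η a k z + smooth η a k (-z) = z ^ 2 + k * η ^ 2 + a ^ 2 / 3 := by
  induction k generalizing z with
  | zero => simpa [smooth] using spline_add_spline_neg ha z
  | succ k ih =>
    have h1 := ih (z + η)
    have h2 := ih (z - η)
    rw [show -(z + η) = -z - η by ring] at h1
    rw [show -(z - η) = -z + η by ring] at h2
    rw [smooth] at h1 h2 ⊢
    rw [Function.iterate_succ_apply', avg, avg]
    push_cast
    linarith

theorem smooth_le {a : ℝ} (ha : 0 < a) (η : ℝ) (k : ℕ) (z : ℝ) :
    smooth η a k z ≤ z ^ 2 + k * η ^ 2 + a ^ 2 / 3 := by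
  linarith [smooth_add_smooth_neg ha η k z, smooth_nonneg ha η k (-z)]

/-- The reflection identity at the origin: the positive side carries half of the variance. This is
the source of the factor `1 / 2` in the main estimate. -/
theorem le_smooth_zero {a : ℝ} (ha : 0 < a) (η : ℝ) (k : ℕ) :
    k * η ^ 2 / 2 ≤ smooth η a k 0 := by
  have h := smooth_add_smooth_neg ha η k 0
  rw [neg_zero] at h
  nlinarith [sq_nonneg a]

/-- One coarse write consumes `J` of the remaining `k` fine steps, or all of them if fewer are left.
The error is three times the remainder constant `1 / (3 * a)` of the spline, which averaging
preserves. -/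
theorem smooth_le_avg {a : ℝ} (ha : 0 < a) {η w : ℝ} {J : ℕ} (hw0 : 0 ≤ w) (hw1 : w ≤ 1)
    (hJ : J * η ^ 2 ≤ w ^ 2) (k : ℕ) (z : ℝ) :
    smooth η a k z ≤ avg w (smooth η a (k - J)) z + 1 / a := by
  have e : smooth η a k = (avg η)^[min k J] (smooth η a (k - J)) := by
    unfold smooth
    rw [← Function.iterate_add_apply]
    congr 2
    omega
  have hm : ((min k J : ℕ) : ℝ) * η ^ 2 ≤ w ^ 2 :=
    (mul_le_mul_of_nonneg_right (by exact_mod_cast min_le_right k J) (sq_nonneg η)).trans hJ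
  have h := ((hasCubicRemainder_spline ha).avg_iterate η (k - J)).avg_iterate_le (by positivity)
    hw0 hw1 hm z
  rw [e]
  refine h.trans (le_of_eq ?_)
  rw [← smooth]
  field_simp

/-! ### Stopped column sums -/

/-- The shortest prefix of a column whose sum exceeds `L` in absolute value (or the column). -/
noncomputable def trim (L : ℝ) (l : List ℤˣ) : List ℤˣ :=
  l.foldl (fun acc v => if |colSum acc| ≤ L then acc ++ [v] else acc) []

/-- The sum of a column, stopped when it exceeds `L` in absolute value. -/
noncomputable def walk (L : ℝ) (l : List ℤˣ) : ℝ := colSum (trim L l)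

theorem colSum_append_singleton (l : List ℤˣ) (v : ℤˣ) :
    colSum (l ++ [v]) = colSum l + ((v : ℤ) : ℝ) := by
  simp [colSum]

theorem trim_nil (L : ℝ) : trim L [] = [] := rfl

theorem walk_nil (L : ℝ) : walk L [] = 0 := by simp [walk, trim_nil, colSum]

theorem trim_append_singleton (L : ℝ) (l : List ℤˣ) (v : ℤˣ) :
    trim L (l ++ [v]) = if |walk L l| ≤ L then trim L l ++ [v] else trim L l := by
  rw [walk, trim, List.foldl_append]
  rfl

theorem walk_append_singleton (L : ℝ) (l : List ℤˣ) (v : ℤˣ) :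
    walk L (l ++ [v]) = if |walk L l| ≤ L then walk L l + ((v : ℤ) : ℝ) else walk L l := by
  rw [walk, trim_append_singleton]
  split_ifs
  · rw [colSum_append_singleton]; rfl
  · rfl

theorem abs_unit (v : ℤˣ) : |((v : ℤ) : ℝ)| = 1 := by
  rcases Int.units_eq_one_or v with rfl | rfl <;> simp

theorem abs_walk_le {L : ℝ} (hL : 0 ≤ L) (l : List ℤˣ) : |walk L l| ≤ L + 1 := by
  induction l using List.reverseRecOn with
  | nil => rw [walk_nil, abs_zero]; linarith
  | append_singleton l v ih =>
    rw [walk_append_singleton]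
    split_ifs with h
    · exact (abs_add_le _ _).trans (by rw [abs_unit]; linarith)
    · exact ih

/-- A stopped sum is frozen above the level, so a final value within the level shows that the
stopping never took place. -/
theorem trim_eq_self {L : ℝ} {l : List ℤˣ} (h : |walk L l| ≤ L) : trim L l = l := by
  induction l using List.reverseRecOn with
  | nil => rfl
  | append_singleton l v ih =>
    rw [walk_append_singleton] at h
    rw [trim_append_singleton]
    split_ifs at h ⊢ with h1
    · rw [ih h1]
    · exact absurd h h1

theorem walk_eq_colSum {L : ℝ} {l : List ℤˣ} (h : |walk L l| ≤ L) : walk L l = colSum l := by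
  rw [walk, trim_eq_self h]

theorem clamp_eq_self {M x : ℝ} (h : |x| ≤ M) : clamp M x = x := by
  rw [clamp, min_eq_right (abs_le.1 h).2, max_eq_right (abs_le.1 h).1]

theorem Iteration.X_eq_walk {n : ℕ} {M : ℝ} {o : Iteration n} {i : Fin n}
    (h : |walk (M - 1) (o.board.col i)| ≤ M - 1) : o.X M i = walk (M - 1) (o.board.col i) := by
  rw [Iteration.X, ← walk_eq_colSum h, clamp_eq_self (by linarith)]

/-- The two ways in which a fair coin changes a stopped sum. -/
theorem walk_coin (L : ℝ) (l : List ℤˣ) :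
    (walk L (l ++ [1]) = walk L l + 1 ∧ walk L (l ++ [-1]) = walk L l - 1) ∨
      (walk L (l ++ [1]) = walk L l ∧ walk L (l ++ [-1]) = walk L l) := by
  simp only [walk_append_singleton]
  split_ifs
  · left; simp [sub_eq_add_neg]
  · right; simp

/-! ### Potentials for the columns of good processes -/

open Classical in
/-- The potential that controls the event that a column sum of process `i` becomes large. -/
noncomputable def overflowPotential (m : ℕ) (L θ : ℝ) (i : Fin n) (B : Finset (Fin n))
    (b : Board n) : ℝ :=
  if i ∈ B then 0 else
    Real.cosh (θ * walk L (b.col i)) * Real.cosh θ ^ (m - (b.col i).length) / Real.cosh (θ * L)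

theorem overflowPotential_nonneg (m : ℕ) (L θ : ℝ) (i : Fin n) (B : Finset (Fin n))
    (b : Board n) : 0 ≤ overflowPotential m L θ i B b := by
  unfold overflowPotential
  have h1 := Real.cosh_pos (θ * walk L (b.col i))
  have h2 := Real.cosh_pos θ
  have h3 := Real.cosh_pos (θ * L)
  split_ifs <;> positivity

/-- A fair step multiplies the mean of `cosh (θ * x)` by `cosh θ`, which the lost factor of the
power compensates. After stopping, that factor is at least `1`, so its loss only helps. -/
theorem isBoardPotential_overflowPotential (m : ℕ) (L θ : ℝ) (i : Fin n) :
    IsBoardPotential m (overflowPotential m L θ i) := by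
  refine ⟨fun B b j v hj hl => ?_, fun B b j hj hl => ?_, fun B b j => ?_⟩
  · by_cases hi : i ∈ B
    · simp [overflowPotential, hi]
    · have hij : i ≠ j := fun h => hi (h ▸ hj)
      simp [overflowPotential, hi, b.write_col_of_ne hij]
  · by_cases hi : i ∈ B
    · simp [overflowPotential, hi]
    · by_cases hij : i = j
      · subst hij
        simp only [overflowPotential, if_neg hi, Board.write_col_self, List.length_append,
          List.length_singleton]
        have e : m - (b.col i).length = (m - ((b.col i).length + 1)) + 1 := by omega
        rw [e, pow_succ]
        generalize m - ((b.col i).length + 1) = k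
        have h2 := Real.one_le_cosh θ
        have h3 := Real.cosh_pos (θ * L)
        have h4 := Real.cosh_pos (θ * walk L (b.col i))
        have h5 : 0 < Real.cosh θ ^ k := by positivity
        rw [← add_div, ← mul_div_assoc]
        refine div_le_div_of_nonneg_right ?_ h3.le
        rcases walk_coin L (b.col i) with ⟨e1, e2⟩ | ⟨e1, e2⟩
        · rw [e1, e2, mul_add, mul_sub, mul_one, Real.cosh_add, Real.cosh_sub]
          apply le_of_eq
          ring
        · rw [e1, e2]
          nlinarith [mul_le_mul_of_nonneg_left h2 (mul_pos h4 h5).le]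
      · simp only [overflowPotential, if_neg hi, b.write_col_of_ne hij]
        linarith
  · by_cases hi : i ∈ insert j B
    · simp only [overflowPotential, if_pos hi]
      exact overflowPotential_nonneg m L θ i B b
    · have hi' : i ∉ B := fun h => hi (Finset.mem_insert_of_mem h)
      simp [overflowPotential, hi, hi']

theorem one_le_overflowPotential {m : ℕ} {L θ : ℝ} (hL : 0 ≤ L) {i : Fin n}
    {B : Finset (Fin n)} {b : Board n} (hi : i ∉ B) (h : L < |walk L (b.col i)|) :
    1 ≤ overflowPotential m L θ i B b := by
  rw [overflowPotential, if_neg hi, one_le_div (Real.cosh_pos _)]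
  have h1 : Real.cosh (θ * L) ≤ Real.cosh (θ * walk L (b.col i)) := by
    rw [Real.cosh_le_cosh, abs_mul, abs_mul, abs_of_nonneg hL]
    exact mul_le_mul_of_nonneg_left h.le (abs_nonneg _)
  exact h1.trans (le_mul_of_one_le_right (Real.cosh_pos _).le (one_le_pow₀ (Real.one_le_cosh θ)))

/-- The choice `θ = L / m` minimizes the Gaussian exponent `m * θ ^ 2 / 2 - θ * L`. -/
theorem overflowPotential_blank_le {m : ℕ} (hm : 0 < m) {L : ℝ} (i : Fin n)
    (B : Finset (Fin n)) (dir : ℤˣ) :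
    overflowPotential m L (L / m) i B ⟨dir, fun _ => []⟩ ≤ 2 * Real.exp (-(L ^ 2 / (2 * m))) := by
  unfold overflowPotential
  split_ifs
  · positivity
  · have hm' : (0 : ℝ) < m := by exact_mod_cast hm
    simp only [walk_nil, mul_zero, Real.cosh_zero, one_mul, List.length_nil, Nat.sub_zero]
    rw [div_le_iff₀ (Real.cosh_pos _)]
    have h1 : Real.cosh (L / m) ^ m ≤ Real.exp (L ^ 2 / (2 * m)) := by
      refine (pow_le_pow_left₀ (Real.cosh_pos _).le (Real.cosh_le_exp_half_sq _) m).trans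
        (le_of_eq ?_)
      rw [← Real.exp_nat_mul]
      congr 1
      field_simp
    have h2 : Real.exp (L / m * L) / 2 ≤ Real.cosh (L / m * L) := by
      rw [Real.cosh_eq]
      linarith [Real.exp_pos (-(L / m * L))]
    have h3 : 2 * Real.exp (-(L ^ 2 / (2 * m))) * (Real.exp (L / m * L) / 2) =
        Real.exp (L ^ 2 / (2 * m)) := by
      rw [show 2 * Real.exp (-(L ^ 2 / (2 * m))) * (Real.exp (L / m * L) / 2) =
        Real.exp (-(L ^ 2 / (2 * m))) * Real.exp (L / m * L) by ring, ← Real.exp_add]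
      congr 1
      field_simp
      ring
    refine h1.trans (h3.symm.le.trans (mul_le_mul_of_nonneg_left h2 (by positivity)))

/-- The probability that a column sum of a good process `i` becomes large. -/
theorem prob_overflow_le {m f T : ℕ} (hm : 0 < m) {L : ℝ} (hL : 0 ≤ L) (i : Fin n)
    (B₀ : Finset (Fin n)) (adv : Adversary n) (N : ℕ) :
    (play m f T B₀ adv N).toOuterMeasure
      {h | ∃ o ∈ h.1.done, i ∉ o.bad ∧ L < |walk L (o.board.col i)|} ≤
      ENNReal.ofReal (T * (2 * Real.exp (-(L ^ 2 / (2 * m))))) := by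
  refine le_trans (MeasureTheory.measure_mono ?_)
    ((isBoardPotential_overflowPotential m L (L / m) i).prob_exists_le
      (overflowPotential_nonneg m L (L / m) i) (overflowPotential_blank_le hm i) (by positivity)
      B₀ adv N)
  rintro h ⟨o, ho, hi, hw⟩
  exact ⟨o, ho, one_le_overflowPotential hL hi hw⟩

open Classical in
/-- The potential that controls the deviation of the good process `i`. -/
noncomputable def devPotential (m : ℕ) (L M : ℝ) (i : Fin n) (B : Finset (Fin n))
    (b : Board n) : ℝ :=
  if i ∈ B then -M else walk L (b.col i) ^ 2 - min (b.col i).length m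

theorem walk_sq_le {L : ℝ} (hL : 0 ≤ L) (l : List ℤˣ) : walk L l ^ 2 ≤ (L + 1) ^ 2 :=
  sq_le_sq' (abs_le.1 (abs_walk_le hL l)).1 (abs_le.1 (abs_walk_le hL l)).2

theorem neg_le_devPotential {m : ℕ} {L M : ℝ} (hm : m ≤ M) (i : Fin n) (B : Finset (Fin n))
    (b : Board n) : -M ≤ devPotential m L M i B b := by
  unfold devPotential
  split_ifs
  · rfl
  · have : ((min (b.col i).length m : ℕ) : ℝ) ≤ m := by exact_mod_cast min_le_right _ _
    nlinarith [sq_nonneg (walk L (b.col i))]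

theorem devPotential_le {m : ℕ} {L M : ℝ} (hL : 0 ≤ L) (hM : (L + 1) ^ 2 ≤ M) (i : Fin n)
    (B : Finset (Fin n)) (b : Board n) : devPotential m L M i B b ≤ M := by
  unfold devPotential
  split_ifs
  · nlinarith
  · have : (0 : ℝ) ≤ ((min (b.col i).length m : ℕ) : ℝ) := by positivity
    linarith [walk_sq_le hL (b.col i)]

/-- A fair step raises the mean square by at most `1`, the amount by which the write count grows.
Corruption drops the value to its lower bound `-M`, hence is never an increase; truncating the count
at `m` secures this bound even on boards that the rules exclude. -/
theorem isBoardPotential_devPotential {m : ℕ} {L M : ℝ} (hm : m ≤ M) (i : Fin n) :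
    IsBoardPotential m (devPotential m L M i) := by
  refine ⟨fun B b j v hj hl => ?_, fun B b j hj hl => ?_, fun B b j => ?_⟩
  · by_cases hi : i ∈ B
    · simp [devPotential, hi]
    · have hij : i ≠ j := fun h => hi (h ▸ hj)
      simp [devPotential, hi, b.write_col_of_ne hij]
  · by_cases hi : i ∈ B
    · simp only [devPotential, if_pos hi]
      linarith
    · by_cases hij : i = j
      · subst hij
        simp only [devPotential, if_neg hi, Board.write_col_self, List.length_append,
          List.length_singleton]
        rw [min_eq_left hl.le, min_eq_left (Nat.succ_le_of_lt hl)]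
        push_cast
        rcases walk_coin L (b.col i) with ⟨e1, e2⟩ | ⟨e1, e2⟩ <;> rw [e1, e2] <;> nlinarith
      · simp only [devPotential, if_neg hi, b.write_col_of_ne hij]
        linarith
  · by_cases hi : i ∈ insert j B
    · rw [devPotential, if_pos hi]
      exact neg_le_devPotential hm i B b
    · have hi' : i ∉ B := fun h => hi (Finset.mem_insert_of_mem h)
      simp [devPotential, hi, hi']

open Classical in
/-- The potential that controls the correlation of the good processes `i` and `j`. -/
noncomputable def corrPotential (L M : ℝ) (i j : Fin n) (B : Finset (Fin n)) (b : Board n) : ℝ :=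
  if i ∈ B ∨ j ∈ B then -M else walk L (b.col i) * walk L (b.col j)

theorem abs_corrPotential_le {L M : ℝ} (hL : 0 ≤ L) (hM : (L + 1) ^ 2 ≤ M) (i j : Fin n)
    (B : Finset (Fin n)) (b : Board n) : |corrPotential L M i j B b| ≤ M := by
  unfold corrPotential
  split_ifs
  · rw [abs_neg, abs_of_nonneg (by nlinarith)]
  · rw [abs_mul]
    have := mul_le_mul (abs_walk_le hL (b.col i)) (abs_walk_le hL (b.col j)) (abs_nonneg _)
      (by linarith)
    linarith

/-- A write touches only one of the two factors and leaves its mean unchanged, because the columns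
are distinct. -/
theorem isBoardPotential_corrPotential (m : ℕ) {L M : ℝ} (hL : 0 ≤ L) (hM : (L + 1) ^ 2 ≤ M)
    {i j : Fin n} (hij : i ≠ j) : IsBoardPotential m (corrPotential L M i j) := by
  refine ⟨fun B b k v hk hl => ?_, fun B b k hk hl => ?_, fun B b k => ?_⟩
  · by_cases hi : i ∈ B ∨ j ∈ B
    · simp [corrPotential, hi]
    · have hik : i ≠ k := fun h => hi (.inl (h ▸ hk))
      have hjk : j ≠ k := fun h => hi (.inr (h ▸ hk))
      simp only [corrPotential, if_neg hi, b.write_col_of_ne hik, b.write_col_of_ne hjk]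
      rfl
  · by_cases hi : i ∈ B ∨ j ∈ B
    · simp only [corrPotential, if_pos hi]
      linarith
    · by_cases hik : i = k
      · subst hik
        simp only [corrPotential, if_neg hi, b.write_col_of_ne hij.symm, Board.write_col_self]
        rcases walk_coin L (b.col i) with ⟨e1, e2⟩ | ⟨e1, e2⟩ <;> rw [e1, e2] <;> nlinarith
      · by_cases hjk : j = k
        · subst hjk
          simp only [corrPotential, if_neg hi, b.write_col_of_ne hij, Board.write_col_self]
          rcases walk_coin L (b.col j) with ⟨e1, e2⟩ | ⟨e1, e2⟩ <;> rw [e1, e2] <;> nlinarith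
        · simp only [corrPotential, if_neg hi, b.write_col_of_ne hik, b.write_col_of_ne hjk]
          linarith
  · by_cases hi : i ∈ insert k B ∨ j ∈ insert k B
    · rw [corrPotential, if_pos hi]
      exact (abs_le.1 (abs_corrPotential_le hL hM i j B b)).1
    · have hi' : ¬ (i ∈ B ∨ j ∈ B) := fun h => hi
        (h.imp Finset.mem_insert_of_mem Finset.mem_insert_of_mem)
      simp only [corrPotential, if_neg hi, if_neg hi', le_refl]

theorem prob_dev_le {m f T : ℕ} {L M : ℝ} (hL : 0 ≤ L) (hm : m ≤ M) (hM : (L + 1) ^ 2 ≤ M)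
    (i : Fin n) (B₀ : Finset (Fin n)) (adv : Adversary n) (N : ℕ) {a : ℝ} (ha : 0 ≤ a)
    (hT : 0 < T) :
    (play m f T B₀ adv N).toOuterMeasure {h | h.1.done.length = T ∧ h.1.current = none ∧
        a ≤ (h.1.done.map fun o => devPotential m L M i o.bad o.board).sum} ≤
      ENNReal.ofReal (Real.exp (-(a ^ 2 / (2 * T * M ^ 2)))) := by
  refine (isBoardPotential_devPotential hm i).prob_sum_ge_le (by nlinarith)
    (neg_le_devPotential hm i) (devPotential_le hL hM i) (fun B dir => ?_) B₀ adv N ha hT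
  unfold devPotential
  split_ifs
  · nlinarith
  · simp [walk_nil]

theorem prob_corr_le {m f T : ℕ} {L M : ℝ} (hL : 0 ≤ L) (hM : (L + 1) ^ 2 ≤ M)
    {i j : Fin n} (hij : i ≠ j) (B₀ : Finset (Fin n)) (adv : Adversary n) (N : ℕ) {a : ℝ}
    (ha : 0 ≤ a) (hT : 0 < T) :
    (play m f T B₀ adv N).toOuterMeasure {h | h.1.done.length = T ∧ h.1.current = none ∧
        a ≤ (h.1.done.map fun o => corrPotential L M i j o.bad o.board).sum} ≤
      ENNReal.ofReal (Real.exp (-(a ^ 2 / (2 * T * M ^ 2)))) := by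
  refine (isBoardPotential_corrPotential m hL hM hij).prob_sum_ge_le (by nlinarith)
    (fun B b => (abs_le.1 (abs_corrPotential_le hL hM i j B b)).1)
    (fun B b => (abs_le.1 (abs_corrPotential_le hL hM i j B b)).2) (fun B dir => ?_) B₀ adv N ha hT
  unfold corrPotential
  split_ifs
  · nlinarith
  · simp [walk_nil]

/-! ### The potential for the weighted sum of the good processes -/

/-- The weighted sum of the stopped columns outside `B`, in the direction opposite to that of the
adversary. -/
noncomputable def counterSum (w : Fin n → ℝ) (L : ℝ) (B : Finset (Fin n)) (b : Board n) : ℝ :=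
  -((b.dir : ℤ) : ℝ) * ∑ i ∈ Bᶜ, w i * walk L (b.col i)

/-- The number of fine steps that represent the writes outside `B`, if a write in column `i`
is represented by `J i` of them. -/
noncomputable def fineSteps (J : Fin n → ℕ) (L : ℝ) (B : Finset (Fin n)) (b : Board n) : ℕ :=
  ∑ i ∈ Bᶜ, J i * (trim L (b.col i)).length

/-- The number of writes outside `B`. -/
def writes (m : ℕ) (B : Finset (Fin n)) (b : Board n) : ℕ := ∑ i ∈ Bᶜ, min (b.col i).length m

open Classical in
/-- The potential that bounds the positive part of `counterSum` from below. -/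
noncomputable def gapPotential (m : ℕ) (w : Fin n → ℝ) (J : Fin n → ℕ) (L M η a : ℝ) (K : ℕ)
    (B₀ B : Finset (Fin n)) (b : Board n) : ℝ :=
  if B ⊆ B₀ then K * η ^ 2 / 2 - smooth η a (K - fineSteps J L B₀ b) (counterSum w L B₀ b) -
    writes m B₀ b / a else -M

theorem sum_compl_write {B : Finset (Fin n)} {i : Fin n} (hi : i ∉ B) {R : Type*} [AddCommGroup R]
    (g : Fin n → List ℤˣ → R) (b : Board n) (v : ℤˣ) :
    ∑ j ∈ Bᶜ, g j ((b.write i v).col j) =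
      ∑ j ∈ Bᶜ, g j (b.col j) + (g i (b.col i ++ [v]) - g i (b.col i)) := by
  have hi' : i ∈ Bᶜ := Finset.mem_compl.2 hi
  rw [← Finset.add_sum_erase _ _ hi', ← Finset.add_sum_erase _ (fun j => g j (b.col j)) hi',
    Board.write_col_self]
  have h : ∑ j ∈ Bᶜ.erase i, g j ((b.write i v).col j) = ∑ j ∈ Bᶜ.erase i, g j (b.col j) :=
    Finset.sum_congr rfl fun j hj => by rw [b.write_col_of_ne (Finset.ne_of_mem_erase hj)]
  rw [h]
  abel

theorem sum_compl_write_nat {B : Finset (Fin n)} {i : Fin n} (hi : i ∉ B)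
    (g : Fin n → List ℤˣ → ℕ) (b : Board n) (v : ℤˣ) {d : ℕ}
    (hd : g i (b.col i ++ [v]) = g i (b.col i) + d) :
    ∑ j ∈ Bᶜ, g j ((b.write i v).col j) = ∑ j ∈ Bᶜ, g j (b.col j) + d := by
  have h := sum_compl_write hi (fun j l => (g j l : ℤ)) b v
  rw [hd] at h
  push_cast at h
  zify
  linarith

theorem sum_compl_write_bad {B : Finset (Fin n)} {i : Fin n} (hi : i ∈ B) {R : Type*}
    [AddCommMonoid R] (g : Fin n → List ℤˣ → R) (b : Board n) (v : ℤˣ) :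
    ∑ j ∈ Bᶜ, g j ((b.write i v).col j) = ∑ j ∈ Bᶜ, g j (b.col j) :=
  Finset.sum_congr rfl fun j hj => by
    rw [b.write_col_of_ne (ne_of_mem_of_not_mem hi (Finset.mem_compl.1 hj)).symm]

theorem fineSteps_write (J : Fin n → ℕ) (L : ℝ) {B : Finset (Fin n)} (b : Board n) {i : Fin n}
    (hi : i ∉ B) (v : ℤˣ) : fineSteps J L B (b.write i v) =
      fineSteps J L B b + if |walk L (b.col i)| ≤ L then J i else 0 := by
  refine sum_compl_write_nat hi (fun j l => J j * (trim L l).length) b v ?_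
  rw [trim_append_singleton]
  split_ifs
  · rw [List.length_append, List.length_singleton]; ring
  · rfl

theorem writes_write (m : ℕ) {B : Finset (Fin n)} (b : Board n) {i : Fin n}
    (hi : i ∉ B) (v : ℤˣ) (hl : (b.col i).length < m) :
    writes m B (b.write i v) = writes m B b + 1 := by
  refine sum_compl_write_nat hi (fun _ l => min l.length m) b v ?_
  simp only [List.length_append, List.length_singleton]
  omega

theorem counterSum_write (w : Fin n → ℝ) (L : ℝ) {B : Finset (Fin n)} (b : Board n) {i : Fin n}
    (hi : i ∉ B) (v : ℤˣ) : counterSum w L B (b.write i v) = counterSum w L B b -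
      ((b.dir : ℤ) : ℝ) * (w i * (walk L (b.col i ++ [v]) - walk L (b.col i))) := by
  have h := sum_compl_write hi (fun j l => w j * walk L l) b v
  rw [counterSum, h, counterSum]
  have e : (b.write i v).dir = b.dir := rfl
  rw [e]
  ring

theorem writes_le (m : ℕ) (B : Finset (Fin n)) (b : Board n) : writes m B b ≤ n * m := by
  refine (Finset.sum_le_card_nsmul _ _ m fun i _ => min_le_right _ _).trans ?_
  rw [smul_eq_mul]
  exact Nat.mul_le_mul_right m (Finset.card_le_univ _ |>.trans (by simp))

theorem abs_counterSum_le {w : Fin n → ℝ} (hw : ∀ i, 0 ≤ w i ∧ w i ≤ 1) {L : ℝ} (hL : 0 ≤ L)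
    (B : Finset (Fin n)) (b : Board n) : |counterSum w L B b| ≤ n * (L + 1) := by
  rw [counterSum, abs_mul, abs_neg, abs_unit, one_mul]
  refine (Finset.abs_sum_le_sum_abs _ _).trans ?_
  refine (Finset.sum_le_card_nsmul _ _ (L + 1) fun i _ => ?_).trans ?_
  · rw [abs_mul, abs_of_nonneg (hw i).1]
    have := mul_le_mul (hw i).2 (abs_walk_le hL (b.col i)) (abs_nonneg _) zero_le_one
    linarith
  · rw [nsmul_eq_mul]
    refine mul_le_mul_of_nonneg_right ?_ (by linarith)
    exact_mod_cast (Finset.card_le_univ _).trans (by simp)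

theorem neg_le_gapPotential {m : ℕ} {w : Fin n → ℝ} (hw : ∀ i, 0 ≤ w i ∧ w i ≤ 1)
    (J : Fin n → ℕ) {L M η a : ℝ} {K : ℕ} (hL : 0 ≤ L) (ha : 0 < a)
    (hM : (n * (L + 1)) ^ 2 + K * η ^ 2 + a ^ 2 / 3 + n * m / a ≤ M)
    (B₀ B : Finset (Fin n)) (b : Board n) : -M ≤ gapPotential m w J L M η a K B₀ B b := by
  unfold gapPotential
  split_ifs
  · have h1 := smooth_le ha η (K - fineSteps J L B₀ b) (counterSum w L B₀ b)
    have h2 : counterSum w L B₀ b ^ 2 ≤ (n * (L + 1)) ^ 2 :=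
      sq_le_sq' (abs_le.1 (abs_counterSum_le hw hL B₀ b)).1
        (abs_le.1 (abs_counterSum_le hw hL B₀ b)).2
    have h3 : (writes m B₀ b : ℝ) / a ≤ n * m / a :=
      div_le_div_of_nonneg_right (by exact_mod_cast writes_le m B₀ b) ha.le
    have h4 : ((K - fineSteps J L B₀ b : ℕ) : ℝ) * η ^ 2 ≤ K * η ^ 2 :=
      mul_le_mul_of_nonneg_right (by exact_mod_cast Nat.sub_le _ _) (sq_nonneg η)
    have h5 : 0 ≤ K * η ^ 2 := by positivity
    linarith
  · rfl

theorem gapPotential_le {m : ℕ} (w : Fin n → ℝ) (J : Fin n → ℕ) (L : ℝ) {M η a : ℝ} {K : ℕ}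
    (ha : 0 < a) (hM : K * η ^ 2 ≤ M)
    (B₀ B : Finset (Fin n)) (b : Board n) : gapPotential m w J L M η a K B₀ B b ≤ M := by
  have h5 : 0 ≤ K * η ^ 2 := by positivity
  unfold gapPotential
  split_ifs
  · have h1 := smooth_nonneg ha η (K - fineSteps J L B₀ b) (counterSum w L B₀ b)
    have h2 : 0 ≤ (writes m B₀ b : ℝ) / a := by positivity
    linarith
  · linarith

theorem gapPotential_blank_le {m : ℕ} (w : Fin n → ℝ) (J : Fin n → ℕ) (L : ℝ) {M η a : ℝ} {K : ℕ}
    (ha : 0 < a) (hM : 0 ≤ M) (B₀ B : Finset (Fin n)) (dir : ℤˣ) :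
    gapPotential m w J L M η a K B₀ B ⟨dir, fun _ => []⟩ ≤ 0 := by
  unfold gapPotential
  split_ifs
  · have h1 := le_smooth_zero ha η K
    simp only [fineSteps, trim_nil, List.length_nil, mul_zero, Finset.sum_const_zero, Nat.sub_zero,
      counterSum, walk_nil, writes, Nat.zero_min, Nat.cast_zero, zero_div, sub_zero]
    linarith
  · linarith

/-- Each write outside `B₀` uses up its fine steps, and the charge `1 / a` per write pays for the
replacement error. A stopped column consumes no fine steps but is still charged. A corruption
outside `B₀` sends the potential to its minimum, which is harmless because the excess is claimed
only for epochs without corruption. -/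
theorem isBoardPotential_gapPotential {m : ℕ} {w : Fin n → ℝ} (hw : ∀ i, 0 ≤ w i ∧ w i ≤ 1)
    {J : Fin n → ℕ} {L M η a : ℝ} {K : ℕ} (hL : 0 ≤ L) (ha : 0 < a)
    (hJ : ∀ i, J i * η ^ 2 ≤ w i ^ 2)
    (hM : (n * (L + 1)) ^ 2 + K * η ^ 2 + a ^ 2 / 3 + n * m / a ≤ M) (B₀ : Finset (Fin n)) :
    IsBoardPotential m (gapPotential m w J L M η a K B₀) := by
  have hbad : ∀ B (b : Board n) j v, j ∈ B₀ →
      gapPotential m w J L M η a K B₀ B (b.write j v) = gapPotential m w J L M η a K B₀ B b := by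
    intro B b j v hj
    have e1 : fineSteps J L B₀ (b.write j v) = fineSteps J L B₀ b :=
      sum_compl_write_bad hj (fun j l => J j * (trim L l).length) b v
    have e2 : writes m B₀ (b.write j v) = writes m B₀ b :=
      sum_compl_write_bad hj (fun _ l => min l.length m) b v
    have e3 : counterSum w L B₀ (b.write j v) = counterSum w L B₀ b := by
      have := sum_compl_write_bad hj (fun j l => w j * walk L l) b v
      rw [counterSum, this]
      rfl
    simp only [gapPotential, e1, e2, e3]
  refine ⟨fun B b j v hj hl => ?_, fun B b j hj hl => ?_, fun B b j => ?_⟩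
  · by_cases hB : B ⊆ B₀
    · exact (hbad B b j v (hB hj)).le
    · simp [gapPotential, hB]
  · by_cases hB : B ⊆ B₀
    · by_cases hj' : j ∈ B₀
      · rw [hbad B b j 1 hj', hbad B b j (-1) hj', two_mul]
      · simp only [gapPotential, if_pos hB, fineSteps_write J L b hj', writes_write m b hj' _ hl,
          counterSum_write w L b hj']
        have e : ((writes m B₀ b + 1 : ℕ) : ℝ) / a = writes m B₀ b / a + 1 / a := by
          push_cast
          rw [add_div]
        rw [e]
        have ha' : 0 < 1 / a := by positivity
        by_cases hs : |walk L (b.col j)| ≤ L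
        · have h := smooth_le_avg ha (hw j).1 (hw j).2 (hJ j) (K - fineSteps J L B₀ b)
            (counterSum w L B₀ b)
          simp only [walk_append_singleton, if_pos hs, add_sub_cancel_left, ← Nat.sub_sub]
          rw [avg] at h
          rcases Int.units_eq_one_or b.dir with hd | hd <;> rw [hd] <;>
          · simp only [Units.val_one, Units.val_neg, Int.cast_one, Int.cast_neg, one_mul,
              mul_one, mul_neg, neg_mul, sub_neg_eq_add, neg_neg]
            linarith
        · simp only [walk_append_singleton, if_neg hs, sub_self, mul_zero, sub_zero, add_zero]
          linarith
    · simp only [gapPotential, if_neg hB]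
      linarith
  · by_cases hB : insert j B ⊆ B₀
    · simp [gapPotential, hB, (Finset.subset_insert j B).trans hB]
    · rw [gapPotential, if_neg hB]
      exact neg_le_gapPotential hw J hL ha hM B₀ B b

theorem prob_gap_le {m f T : ℕ} {w : Fin n → ℝ} (hw : ∀ i, 0 ≤ w i ∧ w i ≤ 1)
    {J : Fin n → ℕ} {L M η a : ℝ} {K : ℕ} (hL : 0 ≤ L) (ha : 0 < a)
    (hJ : ∀ i, J i * η ^ 2 ≤ w i ^ 2)
    (hM : (n * (L + 1)) ^ 2 + K * η ^ 2 + a ^ 2 / 3 + n * m / a ≤ M) (B₀ : Finset (Fin n))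
    (adv : Adversary n) (N : ℕ) {d : ℝ} (hd : 0 ≤ d) (hT : 0 < T) :
    (play m f T B₀ adv N).toOuterMeasure {h | h.1.done.length = T ∧ h.1.current = none ∧
        d ≤ (h.1.done.map fun o => gapPotential m w J L M η a K B₀ o.bad o.board).sum} ≤
      ENNReal.ofReal (Real.exp (-(d ^ 2 / (2 * T * M ^ 2)))) := by
  have h1 : 0 ≤ K * η ^ 2 := by positivity
  have h2 : 0 ≤ (n * m : ℝ) / a := by positivity
  have h3 : 0 < a ^ 2 := by positivity
  have h4 := sq_nonneg (n * (L + 1))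
  exact (isBoardPotential_gapPotential hw hL ha hJ hM B₀).prob_sum_ge_le (by linarith)
    (neg_le_gapPotential hw J hL ha hM B₀) (gapPotential_le w J L ha (by linarith) B₀)
    (gapPotential_blank_le w J L ha (by linarith) B₀) B₀ adv N hd hT

/-! ### What a surviving epoch forces on the bad processes -/

theorem abs_clamp_sub_clamp_le (M x y : ℝ) : |clamp M x - clamp M y| ≤ |x - y| := by
  unfold clamp
  refine (abs_max_sub_max_le_max _ _ _ _).trans ?_
  rw [sub_self, abs_zero, max_eq_right (abs_nonneg _)]
  refine (abs_min_sub_min_le_max _ _ _ _).trans ?_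
  rw [sub_self, abs_zero, max_eq_right (abs_nonneg _)]

theorem abs_colSum_dropLast_sub_le (l : List ℤˣ) : |colSum l.dropLast - colSum l| ≤ 1 := by
  induction l using List.reverseRecOn with
  | nil => simp
  | append_singleton l v _ =>
    rw [List.dropLast_concat, colSum_append_singleton, sub_add_cancel_left, abs_neg, abs_unit]

theorem Iteration.abs_viewX_sub_X_le (M : ℝ) (o : Iteration n) (p i : Fin n) :
    |o.viewX M p i - o.X M i| ≤ if i ∈ o.unseen p then 1 else 0 := by
  unfold Iteration.viewX Iteration.X
  split_ifs
  · exact (abs_clamp_sub_clamp_le _ _ _).trans (abs_colSum_dropLast_sub_le _)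
  · simp

/-- Some process sees the adversary's direction. A hidden cell changes a clamped column sum by at
most `1` and weights are at most `1`, so its view errs by at most `f`. -/
theorem Iteration.neg_le_dir_mul_sum {w : Fin n → ℝ} (hw : ∀ i, 0 ≤ w i ∧ w i ≤ 1) {M : ℝ}
    {f : ℕ} {o : Iteration n} (ho : ¬ o.Ends w M) (hf : ∀ p, (o.unseen p).card ≤ f) :
    -(f : ℝ) ≤ ((o.board.dir : ℤ) : ℝ) * ∑ i, w i * o.X M i := by
  unfold Iteration.Ends at ho
  push Not at ho
  obtain ⟨p, -, hp⟩ := ho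
  have h1 : |∑ i, w i * o.viewX M p i - ∑ i, w i * o.X M i| ≤ f := by
    rw [← Finset.sum_sub_distrib]
    refine (Finset.abs_sum_le_sum_abs _ _).trans ?_
    calc ∑ i, |w i * o.viewX M p i - w i * o.X M i|
        ≤ ∑ i, if i ∈ o.unseen p then (1 : ℝ) else 0 := by
          refine Finset.sum_le_sum fun i _ => ?_
          rw [← mul_sub, abs_mul, abs_of_nonneg (hw i).1]
          refine le_trans ?_ (o.abs_viewX_sub_X_le M p i)
          exact mul_le_of_le_one_left (abs_nonneg _) (hw i).2
      _ = (o.unseen p).card := by simp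
      _ ≤ f := by exact_mod_cast hf p
  have h2 := abs_le.1 h1
  unfold Iteration.coin sgn at hp
  rcases Int.units_eq_one_or o.board.dir with hd | hd <;> rw [hd] at hp ⊢
  · split_ifs at hp with h0
    · simp only [Units.val_one, Int.cast_one, one_mul]
      linarith
    · simp at hp
  · split_ifs at hp with h0
    · simp at hp
    · simp only [Units.val_neg, Units.val_one, Int.cast_neg, Int.cast_one, neg_mul, one_mul]
      linarith

/-- If the game does not end in an iteration, then the bad processes make up for the good ones. -/
theorem Iteration.sq_bad_sum_ge {w : Fin n → ℝ} (hw : ∀ i, 0 ≤ w i ∧ w i ≤ 1) {M : ℝ}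
    {f : ℕ} {o : Iteration n} (ho : ¬ o.Ends w M) (hf : ∀ p, (o.unseen p).card ≤ f)
    (hgood : ∀ i, i ∉ o.bad → |walk (M - 1) (o.board.col i)| ≤ M - 1) {τ : ℝ} (hτ : 0 < τ)
    (hτ1 : τ ≤ 1) :
    (1 - τ) * (max (counterSum w (M - 1) o.bad o.board) 0) ^ 2 - f ^ 2 / τ ≤
      (∑ i ∈ o.bad, w i * o.X M i) ^ 2 := by
  have h := Iteration.neg_le_dir_mul_sum hw ho hf
  rw [← Finset.sum_add_sum_compl o.bad] at h
  have e : ∑ i ∈ o.badᶜ, w i * o.X M i = ∑ i ∈ o.badᶜ, w i * walk (M - 1) (o.board.col i) :=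
    Finset.sum_congr rfl fun i hi => by rw [X_eq_walk (hgood i (Finset.mem_compl.1 hi))]
  rw [e] at h
  have hz : counterSum w (M - 1) o.bad o.board - f ≤
      ((o.board.dir : ℤ) : ℝ) * ∑ i ∈ o.bad, w i * o.X M i := by
    rw [counterSum]
    linarith
  have hd : (((o.board.dir : ℤ) : ℝ)) ^ 2 = 1 := by rw [← sq_abs, abs_unit, one_pow]
  generalize counterSum w (M - 1) o.bad o.board = z at *
  generalize ∑ i ∈ o.bad, w i * o.X M i = x at *
  generalize ((o.board.dir : ℤ) : ℝ) = s at *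
  have hx : x ^ 2 = (s * x) ^ 2 := by rw [mul_pow, hd, one_mul]
  rw [hx]
  have hf0 : (0 : ℝ) ≤ f := by positivity
  rw [tsub_le_iff_right, ← sub_le_iff_le_add', le_div_iff₀ hτ]
  rcases le_total z f with hzf | hzf
  · have hm : (max z 0) ^ 2 ≤ (f : ℝ) ^ 2 :=
      pow_le_pow_left₀ (le_max_right _ _) (max_le hzf hf0) 2
    have h1 : ((1 - τ) * (max z 0) ^ 2) * τ ≤ (f : ℝ) ^ 2 := by
      have h2 : (1 - τ) * τ ≤ 1 := by nlinarith
      have h3 : 0 ≤ (1 - τ) * τ := mul_nonneg (by linarith) hτ.le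
      nlinarith [sq_nonneg (max z 0)]
    nlinarith [sq_nonneg (s * x), mul_nonneg (sq_nonneg (s * x)) hτ.le]
  · rw [max_eq_left (hf0.trans hzf)]
    have h1 : (z - f) ^ 2 ≤ (s * x) ^ 2 := pow_le_pow_left₀ (by linarith) hz 2
    have h2 := mul_le_mul_of_nonneg_right h1 hτ.le
    -- Rests on `τ * (z - f) ^ 2 + f ^ 2 - τ * (1 - τ) * z ^ 2 = (τ * z - f) ^ 2 + τ * f ^ 2`.
    nlinarith [sq_nonneg (τ * z - f)]

theorem list_sum_sq_bad (w : Fin n → ℝ) (M : ℝ) (B : Finset (Fin n)) (D : List (Iteration n)) :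
    (D.map fun o => (∑ i ∈ B, w i * o.X M i) ^ 2).sum =
      ∑ i ∈ B, (D.map fun o => (w i * o.X M i) ^ 2).sum +
        ∑ q ∈ B.offDiag, (D.map fun o => w q.1 * w q.2 * o.X M q.1 * o.X M q.2).sum := by
  induction D with
  | nil => simp
  | cons o D ih =>
    simp only [List.map_cons, List.sum_cons, ih, Finset.sum_add_distrib]
    have h : (∑ i ∈ B, w i * o.X M i) ^ 2 = ∑ i ∈ B, (w i * o.X M i) ^ 2 +
        ∑ q ∈ B.offDiag, w q.1 * w q.2 * o.X M q.1 * o.X M q.2 := by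
      rw [sq, Finset.sum_mul_sum, ← Finset.sum_product', ← Finset.diag_union_offDiag,
        Finset.sum_union (Finset.disjoint_diag_offDiag B), Finset.sum_diag]
      congr 1
      · exact Finset.sum_congr rfl fun i _ => by ring
      · exact Finset.sum_congr rfl fun q _ => by ring
    rw [h]
    ring

/-- Expanding the square yields exactly the deviations and correlations, each at most its threshold
plus its excess. Using `w i ^ 2 ≤ w i` makes the thresholds linear in the weights, as the weight
invariant is. -/
theorem State.sum_sq_bad_le {w : Fin n → ℝ} (hw : ∀ i, 0 ≤ w i ∧ w i ≤ 1) (M : ℝ) {α β : ℝ}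
    (hα : 0 ≤ α) (hβ : 0 ≤ β) {f : ℕ} (s : State n) (hf : s.bad.card ≤ f) :
    (s.done.map fun o => (∑ i ∈ s.bad, w i * o.X M i) ^ 2).sum ≤
      s.excess w M α β + (∑ i ∈ s.bad, w i) * α + f ^ 2 * β := by
  rw [list_sum_sq_bad, State.excess]
  have h1 : ∑ i ∈ s.bad, (s.done.map fun o => (w i * o.X M i) ^ 2).sum ≤
      ∑ i ∈ s.bad, max 0 (s.dev w M i - w i ^ 2 * α) + (∑ i ∈ s.bad, w i) * α := by
    rw [Finset.sum_mul, ← Finset.sum_add_distrib]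
    refine Finset.sum_le_sum fun i _ => ?_
    have h2 := le_max_right 0 (s.dev w M i - w i ^ 2 * α)
    have h3 : w i ^ 2 * α ≤ w i * α :=
      mul_le_mul_of_nonneg_right (by nlinarith [hw i]) hα
    rw [State.dev] at h2 ⊢
    linarith
  have h2 : ∑ q ∈ s.bad.offDiag, (s.done.map fun o => w q.1 * w q.2 * o.X M q.1 * o.X M q.2).sum ≤
      ∑ q ∈ s.bad.offDiag, max 0 (s.corr w M q.1 q.2 - w q.1 * w q.2 * β) + f ^ 2 * β := by
    have h3 : ∑ _q ∈ s.bad.offDiag, β ≤ f ^ 2 * β := by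
      rw [Finset.sum_const, nsmul_eq_mul, Finset.offDiag_card]
      refine mul_le_mul_of_nonneg_right ?_ hβ
      have : s.bad.card * s.bad.card ≤ f * f := Nat.mul_le_mul hf hf
      rw [sq]
      exact_mod_cast (Nat.sub_le _ _).trans this
    refine le_trans ?_ (add_le_add_right h3 _)
    rw [← Finset.sum_add_distrib]
    refine Finset.sum_le_sum fun q _ => ?_
    have h2 := le_max_right 0 (s.corr w M q.1 q.2 - w q.1 * w q.2 * β)
    have h3 : w q.1 * w q.2 * β ≤ β :=
      mul_le_of_le_one_left hβ (mul_le_one₀ (hw q.1).2 (hw q.2).1 (hw q.2).2)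
    rw [State.corr] at h2 ⊢
    linarith
  linarith

/-- The weighted number of writes of good processes on a complete blackboard. -/
theorem le_fineSteps {w : Fin n → ℝ} (hw : ∀ i, 0 ≤ w i ∧ w i ≤ 1) {m f r : ℕ} {L : ℝ}
    {B : Finset (Fin n)} {b : Board n} (hgood : ∀ i, i ∉ B → |walk L (b.col i)| ≤ L)
    (hfull : n ≤ (b.full m).card + f) :
    (m : ℝ) * (r * (n - f - B.card - 2 * ∑ i ∈ Bᶜ, (1 - w i)) - n) ≤
      fineSteps (fun i => ⌊w i ^ 2 * r⌋₊) L B b := by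
  have hsub : b.full m \ B ⊆ Bᶜ := fun i hi =>
    Finset.mem_compl.2 (Finset.mem_sdiff.1 hi).2
  have hw1 : ∀ i, 0 ≤ 1 - w i := fun i => by linarith [(hw i).2]
  have h1 : ∑ i ∈ b.full m \ B, ((m : ℝ) * (r * (1 - 2 * (1 - w i)) - 1)) ≤
      fineSteps (fun i => ⌊w i ^ 2 * r⌋₊) L B b := by
    rw [fineSteps, Nat.cast_sum]
    refine le_trans (Finset.sum_le_sum fun i hi => ?_)
      (Finset.sum_le_sum_of_subset_of_nonneg hsub fun i _ _ => by positivity)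
    rw [trim_eq_self (hgood i (Finset.mem_sdiff.1 hi).2),
      (Finset.mem_filter.1 (Finset.mem_sdiff.1 hi).1).2]
    push_cast
    rw [mul_comm (m : ℝ)]
    refine mul_le_mul_of_nonneg_right ?_ (by positivity)
    have h2 := Nat.lt_floor_add_one (w i ^ 2 * r)
    -- The tangent bound for `w ^ 2` at `1`. The subtracted `1` in the summand pays for the floor.
    have h3 : (r : ℝ) * (1 - 2 * (1 - w i)) ≤ w i ^ 2 * r := by
      have : (0 : ℝ) ≤ r := by positivity
      nlinarith [sq_nonneg (1 - w i)]
    linarith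
  refine le_trans ?_ h1
  have e : ∑ i ∈ b.full m \ B, ((m : ℝ) * (r * (1 - 2 * (1 - w i)) - 1)) =
      m * (r * ((b.full m \ B).card - 2 * ∑ i ∈ b.full m \ B, (1 - w i)) -
        (b.full m \ B).card) := by
    rw [← Finset.mul_sum, Finset.sum_sub_distrib _ (fun _ => (1 : ℝ)), ← Finset.mul_sum,
      Finset.sum_sub_distrib (fun _ => (1 : ℝ)) (fun i => 2 * (1 - w i)), ← Finset.mul_sum,
      Finset.sum_const, nsmul_eq_mul, mul_one]
  rw [e]
  refine mul_le_mul_of_nonneg_left ?_ (by positivity)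
  have h4 : ∑ i ∈ b.full m \ B, (1 - w i) ≤ ∑ i ∈ Bᶜ, (1 - w i) :=
    Finset.sum_le_sum_of_subset_of_nonneg hsub fun i _ _ => hw1 i
  have h5 : (n : ℝ) - f - B.card ≤ (b.full m \ B).card := by
    have := Finset.le_card_sdiff B (b.full m)
    have h6 : n ≤ (b.full m \ B).card + B.card + f := by omega
    have h7 : (n : ℝ) ≤ (b.full m \ B).card + B.card + f := by exact_mod_cast h6
    linarith
  have h6 : ((b.full m \ B).card : ℝ) ≤ n := by
    exact_mod_cast (Finset.card_le_univ _).trans (by simp)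
  have : (0 : ℝ) ≤ r := by positivity
  have := mul_le_mul_of_nonneg_left
    (show (n : ℝ) - f - B.card - 2 * ∑ i ∈ Bᶜ, (1 - w i) ≤
      (b.full m \ B).card - 2 * ∑ i ∈ b.full m \ B, (1 - w i) by linarith) this
  linarith

theorem list_sum_map_affine {ι : Type*} (D : List ι) (g : ι → ℝ) (x y : ℝ) :
    (D.map fun o => x + y * g o).sum = D.length * x + y * (D.map g).sum := by
  induction D with
  | nil => simp
  | cons o D ih =>
    simp only [List.map_cons, List.sum_cons, ih, List.length_cons]
    push_cast
    ring

/-- The bad processes of an epoch in which the game did not end have a large total score. -/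
theorem State.sum_sq_bad_ge {w : Fin n → ℝ} (hw : ∀ i, 0 ≤ w i ∧ w i ≤ 1) {m f T r K : ℕ}
    {B₀ : Finset (Fin n)} {s : State n} (hs : Legal m f T B₀ s) {M M' a τ : ℝ} (ha : 0 < a)
    (hsurv : s.Survived T w M) (hbad : s.bad = B₀)
    (hgood : ∀ o ∈ s.done, ∀ i, i ∉ o.bad → |walk (M - 1) (o.board.col i)| ≤ M - 1)
    (hτ : 0 < τ) (hτ1 : τ ≤ 1)
    (hK : K = ⌊(m : ℝ) * (r * (n - f - B₀.card - 2 * ∑ i ∈ B₀ᶜ, (1 - w i)) - n)⌋₊) {η d : ℝ}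
    (hd : (s.done.map fun o => gapPotential m w (fun i => ⌊w i ^ 2 * r⌋₊) (M - 1) M' η a K B₀
      o.bad o.board).sum ≤ d) :
    T * ((1 - τ) * (K * η ^ 2 / 2 - a ^ 2 / 3 - n * m / a) - f ^ 2 / τ) - (1 - τ) * d ≤
      (s.done.map fun o => (∑ i ∈ s.bad, w i * o.X M i) ^ 2).sum := by
  have hob : ∀ o ∈ s.done, o.bad = B₀ := fun o ho =>
    Finset.Subset.antisymm (hbad ▸ (hs.done_bad o ho).2) (hs.done_bad o ho).1
  have key : ∀ o ∈ s.done,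
      ((1 - τ) * (K * η ^ 2 / 2 - a ^ 2 / 3 - n * m / a) - f ^ 2 / τ) + (-(1 - τ)) *
        gapPotential m w (fun i => ⌊w i ^ 2 * r⌋₊) (M - 1) M' η a K B₀ o.bad o.board ≤
      (∑ i ∈ s.bad, w i * o.X M i) ^ 2 := by
    intro o ho
    have h1 := Iteration.sq_bad_sum_ge hw (hsurv.2 o ho) (hs.done_unseen o ho) (hgood o ho) hτ hτ1
    have hg := hgood o ho
    rw [hob o ho] at h1 hg
    rw [hob o ho, hbad]
    have h2 := hK.le.trans
      (Nat.floor_le_of_le (le_fineSteps (r := r) hw hg (hs.done_full o ho)))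
    -- On a complete blackboard the fine steps are exhausted, by truncated subtraction even when
    -- there are more than `K`, so only the bare spline remains.
    have h3 : K - fineSteps (fun i => ⌊w i ^ 2 * r⌋₊) (M - 1) B₀ o.board = 0 :=
      Nat.sub_eq_zero_of_le h2
    rw [gapPotential, if_pos subset_rfl, h3]
    have h4 : smooth η a 0 (counterSum w (M - 1) B₀ o.board) ≤
        (max (counterSum w (M - 1) B₀ o.board) 0) ^ 2 + a ^ 2 / 3 := spline_le ha _
    have h5 : (writes m B₀ o.board : ℝ) / a ≤ n * m / a :=
      div_le_div_of_nonneg_right (by exact_mod_cast writes_le m B₀ o.board) ha.le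
    have h6 := mul_le_mul_of_nonneg_left (show K * η ^ 2 / 2 - a ^ 2 / 3 - n * m / a -
      (K * η ^ 2 / 2 - smooth η a 0 (counterSum w (M - 1) B₀ o.board) -
        writes m B₀ o.board / a) ≤ (max (counterSum w (M - 1) B₀ o.board) 0) ^ 2 by linarith)
      (show 0 ≤ 1 - τ by linarith)
    linarith
  have h := List.sum_le_sum key
  rw [list_sum_map_affine, hsurv.1] at h
  have := mul_le_mul_of_nonneg_left hd (show 0 ≤ 1 - τ by linarith)
  linarith

/-! ### Numerical estimates and the choice of parameters -/

/-- The bookkeeping of the error terms. -/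
theorem gap_arithmetic {n f m T b dB dG ε r Q β d : ℝ} (hf : 1 ≤ f) (hn : n = (4 + ε) * f)
    (hε : 0 < ε) (hε1 : ε ≤ 1 / 2) (hεf : 1 ≤ ε * f) (hm : 1000000 * n ≤ m * ε ^ 2)
    (hT : 0 ≤ T) (hb : b ≤ f) (hdB : 0 ≤ dB)
    (hdG : dG ≤ dB + ε ^ 2 * f / 8) (hr : 100 ≤ r * ε)
    (hQ : m * (r * (n - f - b - 2 * dG) - n) - 1 ≤ Q * r) (hQ' : Q ≤ n * m) (hβ0 : 0 ≤ β)
    (hβ : 1000 * n * β ≤ m * T * ε) (hd0 : 0 ≤ d) (hd : 100 * d ≤ T * (m * ε * f)) :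
    ε / 16 * f * (m * T + β) ≤
      T * ((1 - ε / 50) * (Q / 2 - (100 / ε) ^ 2 / 3 - n * m / (100 / ε)) - f ^ 2 / (ε / 50)) -
        (1 - ε / 50) * d - (b - dB) * (m * T + β) - f ^ 2 * β := by
  have hf0 : 0 < f := by linarith
  have hεf' : ε * f ≤ f / 2 := by linarith [mul_le_mul_of_nonneg_right hε1 hf0.le]
  have hn4 : 4 * f ≤ n := by linarith
  have hn5 : n ≤ 4.5 * f := by linarith
  have hn0 : 0 ≤ n := by linarith
  have hr0 : 0 < r := pos_of_mul_pos_left (by linarith) hε.le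
  have hm0 : 0 < m := pos_of_mul_pos_left (show 0 < m * ε ^ 2 by linarith) (sq_nonneg ε)
  obtain ⟨u, hu⟩ : ∃ u, u = m * ε * f := ⟨_, rfl⟩
  rw [← hu] at hd
  have hum : m ≤ u := by
    rw [hu, mul_assoc]
    exact le_mul_of_one_le_right hm0.le hεf
  have hu0 : 0 < u := by linarith
  have hnm : n * m * ε ≤ 4.5 * u := by
    have := mul_le_mul_of_nonneg_right hn5 (mul_pos hm0 hε).le
    rw [hu]
    linarith
  have hmn : 4000000 ≤ m * ε ^ 2 := by linarith
  have hm1 : 4000000 ≤ m := by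
    have : m * ε ^ 2 ≤ m := mul_le_of_le_one_right hm0.le (pow_le_one₀ hε.le (by linarith))
    linarith
  have t1 : (100 / ε) ^ 2 / 3 ≤ 0.01 * u := by
    rw [div_pow, div_div, div_le_iff₀ (by positivity)]
    linarith [mul_le_mul_of_nonneg_right hum (sq_nonneg ε)]
  have t2 : n * m / (100 / ε) ≤ 0.045 * u := by
    rw [div_div_eq_mul_div, div_le_iff₀ (by norm_num)]
    linarith
  have t3 : f ^ 2 / (ε / 50) ≤ 0.01 * u := by
    rw [div_le_iff₀ (by positivity), hu]
    have h1 : 4000000 * f * f ≤ m * ε ^ 2 * f :=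
      mul_le_mul_of_nonneg_right (by linarith) (by linarith)
    have h2 : 0 ≤ f * f := by positivity
    have e : 0.01 * (m * ε * f) * (ε / 50) = 0.0002 * (m * ε ^ 2 * f) := by ring
    rw [e, sq]
    linarith
  have t4 : ε / 50 * (Q / 2) ≤ 0.045 * u := by
    have := mul_le_mul_of_nonneg_left hQ' hε.le
    linarith
  -- The main gain: `n - f - b ≥ 2 * b + ε * f` because `b ≤ f`, and the invariant costs at most `ε
  -- * f / 8` of it. Half of `7 / 8 * u` survives, minus the floor losses.
  have t5 : m * (b - dB) + 0.41 * u ≤ Q / 2 := by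
    have h1 : m * (r * (2 * b + ε * f - 2 * dB - ε * f / 8)) ≤ m * (r * (n - f - b - 2 * dG)) := by
      refine mul_le_mul_of_nonneg_left (mul_le_mul_of_nonneg_left ?_ hr0.le) hm0.le
      have : ε ^ 2 * f ≤ ε * f / 2 := by
        have := mul_le_mul_of_nonneg_right hε1 (show 0 ≤ ε * f by linarith)
        rw [sq, mul_assoc]
        linarith
      linarith
    have h2 : 100 * (n * m) ≤ 4.5 * u * r := by
      have h3 := mul_le_mul_of_nonneg_right hnm hr0.le
      have h4 := mul_le_mul_of_nonneg_left hr (mul_nonneg hn0 hm0.le)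
      linarith
    have h3 : 1 ≤ 0.005 * u * r := by
      have h4 : r * ε ≤ r * (1 / 2) := mul_le_mul_of_nonneg_left hε1 hr0.le
      have h5 : 4000000 * 200 ≤ u * r :=
        mul_le_mul (by linarith) (by linarith) (by norm_num) hu0.le
      linarith
    have h4 : (2 * (m * (b - dB)) + 0.82 * u) * r ≤ Q * r := by
      have e : m * (r * (2 * b + ε * f - 2 * dB - ε * f / 8)) =
        (2 * (m * (b - dB)) + 7 / 8 * u) * r := by rw [hu]; ring
      have : 0 ≤ u * r := mul_nonneg (by linarith) hr0.le
      linarith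
    linarith [le_of_mul_le_mul_right h4 hr0]
  have t6 : m * (b - dB) + 0.25 * u ≤
      (1 - ε / 50) * (Q / 2 - (100 / ε) ^ 2 / 3 - n * m / (100 / ε)) - f ^ 2 / (ε / 50) := by
    have h1 : 0 ≤ ε / 50 * ((100 / ε) ^ 2 / 3) := by positivity
    have h2 : 0 ≤ ε / 50 * (n * m / (100 / ε)) := by positivity
    linarith
  have t7 := mul_le_mul_of_nonneg_left t6 hT
  have t8 : f * (1000 * β) ≤ m * T * ε := by
    have := mul_le_mul_of_nonneg_right (show f ≤ n by linarith) hβ0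
    linarith
  have t9 : f ^ 2 * β ≤ 0.001 * (T * u) := by
    have := mul_le_mul_of_nonneg_left t8 hf0.le
    rw [hu]
    linarith
  have hff : f ≤ f ^ 2 := le_self_pow₀ hf two_ne_zero
  have t10 : (b - dB) * β ≤ 0.001 * (T * u) :=
    (mul_le_mul_of_nonneg_right (by linarith) hβ0).trans t9
  have t11 : ε / 16 * f * β ≤ 0.001 * (T * u) :=
    (mul_le_mul_of_nonneg_right (by linarith) hβ0).trans t9
  have t12 : (1 - ε / 50) * d ≤ 0.01 * (T * u) := by
    have := mul_nonneg hε.le hd0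
    linarith
  have t13 : ε / 16 * f * (m * T) = T * u / 16 := by rw [hu]; ring
  have t14 : 0 ≤ T * u := mul_nonneg hT (by linarith)
  linarith

/-- The parameters of an epoch that the proof needs. -/
structure Params (c : ℝ) (n f m T : ℕ) (ε : ℝ) : Prop where
  three_le : 3 ≤ n
  le_c : 80 ≤ c
  pos : 0 < ε
  le_half : ε ≤ 1 / 2
  eq : (n : ℝ) = (4 + ε) * f
  le_m : 1000000 * (n / ε ^ 2) ≤ m
  le_T : 1000000 * c ^ 3 * (n ^ 2 * Real.log n ^ 3 / ε ^ 2) ≤ T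
  T_le : T ≤ (n : ℝ) * (n ^ 2 * Real.log n ^ 3 / ε ^ 2)

variable {c ε : ℝ} {f m T : ℕ}

theorem betaT_nonneg : 0 ≤ betaT c n m T := by
  unfold betaT
  positivity

namespace Params

theorem one_le_log (P : Params c n f m T ε) : 1 ≤ Real.log n := by
  rw [Real.le_log_iff_exp_le (by have := P.three_le; positivity)]
  have h : (3 : ℝ) ≤ n := by exact_mod_cast P.three_le
  linarith [Real.exp_one_lt_d9]

theorem le_mul_log (P : Params c n f m T ε) : 80 ≤ c * Real.log n := by
  nlinarith [P.one_le_log, P.le_c]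

theorem one_le_f (P : Params c n f m T ε) : 1 ≤ f := by
  rw [Nat.one_le_iff_ne_zero]
  rintro rfl
  have := P.eq
  have h3 := P.three_le
  simp only [Nat.cast_zero, mul_zero, Nat.cast_eq_zero] at this
  omega

/-- Integrality: `ε * f = n - 4 * f` is a positive integer. Hence `1 / ε` is polynomially bounded in
`n`. -/
theorem one_le_mul_f (P : Params c n f m T ε) : 1 ≤ ε * f := by
  have h1 : ε * f = ((n - 4 * f : ℤ) : ℝ) := by
    push_cast
    linarith [P.eq]
  have hf : (1 : ℝ) ≤ f := by exact_mod_cast P.one_le_f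
  have h2 : (0 : ℝ) < ((n - 4 * f : ℤ) : ℝ) := by
    rw [← h1]
    exact mul_pos P.pos (by linarith)
  rw [h1]
  exact_mod_cast Int.cast_pos.1 h2

theorem le_m' (P : Params c n f m T ε) : 1000000 * (n : ℝ) ≤ m * ε ^ 2 := by
  have h := P.le_m
  rwa [← mul_div_assoc, div_le_iff₀ (pow_pos P.pos 2)] at h

theorem le_m'' (P : Params c n f m T ε) : 1000000 ≤ (m : ℝ) * ε ^ 2 := by
  have h : (3 : ℝ) ≤ n := by exact_mod_cast P.three_le
  linarith [P.le_m']

theorem million_le_m (P : Params c n f m T ε) : 1000000 ≤ (m : ℝ) := by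
  have h1 := P.le_m''
  have h2 : ε ^ 2 ≤ 1 := by nlinarith [P.pos, P.le_half]
  have h3 : (0 : ℝ) ≤ m := by positivity
  nlinarith

theorem le_sqrt_T (P : Params c n f m T ε) :
    1000 * n * √(c * Real.log n) ^ 3 ≤ ε * √T := by
  have h80 := P.le_mul_log
  have h : (1000 * n * √(c * Real.log n) ^ 3 / ε) ^ 2 ≤ T := by
    refine le_trans (le_of_eq ?_) P.le_T
    have e : (√(c * Real.log n) ^ 3) ^ 2 = (c * Real.log n) ^ 3 := by
      rw [← pow_mul, mul_comm 3 2, pow_mul, Real.sq_sqrt (by linarith)]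
    rw [div_pow, mul_pow, mul_pow, e]
    ring
  have h' := Real.le_sqrt_of_sq_le h
  rw [div_le_iff₀ P.pos] at h'
  linarith

theorem T_pos (P : Params c n f m T ε) : 0 < T := by
  have h1 := P.le_sqrt_T
  have h80 := P.le_mul_log
  rcases Nat.eq_zero_or_pos T with h | h
  · subst h
    rw [Nat.cast_zero, Real.sqrt_zero, mul_zero] at h1
    have : (0 : ℝ) < n := by have := P.three_le; positivity
    have h2 : 0 < √(c * Real.log n) := Real.sqrt_pos.2 (by linarith)
    have : 0 < 1000 * n * √(c * Real.log n) ^ 3 := by positivity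
    linarith
  · exact h

theorem Xmax_sq (P : Params c n f m T ε) : Xmax c n m ^ 2 = c * Real.log n * m := by
  rw [Xmax, Real.sq_sqrt]
  · ring
  · have := P.le_mul_log
    have : 0 ≤ c * Real.log n * m := by positivity
    linarith

theorem four_le_Xmax (P : Params c n f m T ε) : 4 ≤ Xmax c n m := by
  refine Real.le_sqrt_of_sq_le ?_
  nlinarith [P.le_mul_log, P.million_le_m]

theorem betaT_eq (P : Params c n f m T ε) :
    betaT c n m T = m * (√T * √(c * Real.log n) ^ 3) := by
  have h80 := P.le_mul_log
  rw [betaT, Real.sqrt_mul (by positivity)]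
  congr 2
  rw [Real.sqrt_eq_iff_mul_self_eq (by positivity) (by positivity)]
  rw [← pow_two, ← pow_mul, mul_comm 3 2, pow_mul, Real.sq_sqrt (by linarith)]

theorem betaT_le (P : Params c n f m T ε) : 1000 * n * betaT c n m T ≤ m * T * ε := by
  rw [P.betaT_eq]
  have h := mul_le_mul_of_nonneg_left P.le_sqrt_T (show (0 : ℝ) ≤ m * √T by positivity)
  have e : (√T : ℝ) * √T = T := Real.mul_self_sqrt (by positivity)
  calc _ = m * √T * (1000 * n * √(c * Real.log n) ^ 3) := by ring
    _ ≤ m * √T * (ε * √T) := h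
    _ = m * (√T * √T) * ε := by ring
    _ = m * T * ε := by rw [e]

theorem exp_tail (P : Params c n f m T ε) {M d : ℝ} (hM : 0 < M)
    (hd : d = M * (√T * √(c * Real.log n))) :
    Real.exp (-(d ^ 2 / (2 * T * M ^ 2))) ≤ Real.exp (-(c * Real.log n / 4)) := by
  have h80 := P.le_mul_log
  have hT : (0 : ℝ) < T := by exact_mod_cast P.T_pos
  rw [Real.exp_le_exp, neg_le_neg_iff, hd, mul_pow, mul_pow, Real.sq_sqrt (by positivity),
    Real.sq_sqrt (by linarith)]
  have e : M ^ 2 * (T * (c * Real.log n)) / (2 * T * M ^ 2) = c * Real.log n / 2 := by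
    field_simp
  rw [e]
  linarith

theorem betaT_eq' (P : Params c n f m T ε) :
    betaT c n m T = c * Real.log n * m * (√T * √(c * Real.log n)) := by
  have h80 := P.le_mul_log
  have e : √(c * Real.log n) ^ 3 = (c * Real.log n) * √(c * Real.log n) := by
    rw [pow_succ, Real.sq_sqrt (by linarith)]
  rw [P.betaT_eq, e]
  ring

/-- Lowering the level by `1` at most halves its square, as `Xmax ≥ 4`. -/
theorem overflow_tail (P : Params c n f m T ε) :
    Real.exp (-((Xmax c n m - 1) ^ 2 / (2 * m))) ≤ Real.exp (-(c * Real.log n / 4)) := by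
  have hm := P.million_le_m
  rw [Real.exp_le_exp, neg_le_neg_iff, le_div_iff₀ (by linarith)]
  nlinarith [P.Xmax_sq, P.four_le_Xmax]

/-- The terms count overflows (two tails for each process and iteration), deviations, ordered pairs,
and the gap sum. The prefactor is at most `n ^ 10`, and `10 - c / 4 ≤ -c / 8` exactly when `c ≥ 80`.
-/
theorem union_bound (P : Params c n f m T ε) :
    (2 * n * T + n + n ^ 2 + 1 : ℝ) * Real.exp (-(c * Real.log n / 4)) ≤
      (n : ℝ) ^ (-(1 / 8 * c)) := by
  have h3 : (3 : ℝ) ≤ n := by exact_mod_cast P.three_le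
  have hn : (0 : ℝ) < n := by linarith
  have hlog := P.one_le_log
  have hlogn : Real.log n ≤ n := (Real.log_le_sub_one_of_pos hn).trans (by linarith)
  have hinv : 1 / ε ≤ n := by
    rw [div_le_iff₀ P.pos]
    have := P.one_le_mul_f
    nlinarith [P.eq, P.pos]
  have hT : (T : ℝ) ≤ n ^ 8 := by
    refine P.T_le.trans ?_
    have h1 : Real.log n ^ 3 ≤ n ^ 3 := pow_le_pow_left₀ (by linarith) hlogn 3
    have h2 : (1 / ε) ^ 2 ≤ n ^ 2 := pow_le_pow_left₀ (by have := P.pos; positivity) hinv 2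
    have h4 : Real.log n ^ 3 * (1 / ε) ^ 2 ≤ n ^ 3 * n ^ 2 :=
      mul_le_mul h1 h2 (by positivity) (by positivity)
    calc (n : ℝ) * (n ^ 2 * Real.log n ^ 3 / ε ^ 2) = n ^ 3 * (Real.log n ^ 3 * (1 / ε) ^ 2) := by
          ring
      _ ≤ (n : ℝ) ^ 3 * (n ^ 3 * n ^ 2) := mul_le_mul_of_nonneg_left h4 (by positivity)
      _ = (n : ℝ) ^ 8 := by ring
  have hpoly : (2 * n * T + n + n ^ 2 + 1 : ℝ) ≤ n ^ 10 := by
    have h1 : (2 * n * T : ℝ) ≤ 2 * n * n ^ 8 := mul_le_mul_of_nonneg_left hT (by positivity)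
    have h2 : (1 : ℝ) ≤ n ^ 6 := one_le_pow₀ (by linarith)
    have h5 : (n ^ 3 : ℝ) ≤ n ^ 9 := pow_le_pow_right₀ (by linarith) (by norm_num)
    have h4 : (n + n ^ 2 + 1 : ℝ) ≤ n ^ 3 := by nlinarith [sq_nonneg (n : ℝ)]
    have h6 : (3 * n ^ 9 : ℝ) ≤ n ^ 10 := by
      rw [pow_succ (n : ℝ) 9, mul_comm]
      exact mul_le_mul_of_nonneg_left h3 (by positivity)
    have e : (2 * n * n ^ 8 : ℝ) = 2 * n ^ 9 := by ring
    linarith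
  refine (mul_le_mul_of_nonneg_right hpoly (Real.exp_pos _).le).trans ?_
  rw [Real.rpow_def_of_pos hn]
  have e : (n : ℝ) ^ 10 = Real.exp (10 * Real.log n) := by
    rw [show (10 : ℝ) = ((10 : ℕ) : ℝ) by norm_num, Real.exp_nat_mul, Real.exp_log hn]
  rw [e, ← Real.exp_add, Real.exp_le_exp]
  nlinarith [P.le_c]

end Params

/-! ### The exceptional event and the conclusion -/

theorem one_sub_le_toReal_toOuterMeasure {α : Type*} (p : PMF α) (S : Set α) {x : ℝ}
    (h : p.toOuterMeasure Sᶜ ≤ ENNReal.ofReal x) (hx : 0 ≤ x) :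
    1 - x ≤ (p.toOuterMeasure S).toReal := by
  have h1 : p.toOuterMeasure Set.univ = 1 :=
    (p.toOuterMeasure_apply_eq_one_iff _).2 (Set.subset_univ _)
  have h2 : (1 : ENNReal) ≤ p.toOuterMeasure S + ENNReal.ofReal x := by
    rw [← h1, ← Set.union_compl_self S]
    exact (MeasureTheory.measure_union_le _ _).trans (add_le_add_right h _)
  have h3 : p.toOuterMeasure S ≠ ⊤ :=
    ne_top_of_le_ne_top ENNReal.one_ne_top
      (h1 ▸ MeasureTheory.measure_mono (Set.subset_univ S))
  have h4 := ENNReal.toReal_mono (ENNReal.add_ne_top.2 ⟨h3, ENNReal.ofReal_ne_top⟩) h2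
  rw [ENNReal.toReal_add h3 ENNReal.ofReal_ne_top, ENNReal.toReal_ofReal hx,
    ENNReal.toReal_one] at h4
  linarith

theorem measure_iUnion_fin_le {α : Type*} (p : PMF α) {n : ℕ} (E : Fin n → Set α) {x : ℝ}
    (h : ∀ i, p.toOuterMeasure (E i) ≤ ENNReal.ofReal x) :
    p.toOuterMeasure (⋃ i, E i) ≤ ENNReal.ofReal (n * x) := by
  refine (MeasureTheory.measure_iUnion_fintype_le _ _).trans
    ((Finset.sum_le_sum fun i _ => h i).trans ?_)
  rw [Finset.sum_const, nsmul_eq_mul, Finset.card_fin, ENNReal.ofReal_mul (by positivity),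
    ENNReal.ofReal_natCast]

theorem Legal.notMem_bad {B₀ : Finset (Fin n)} {s : State n} (hs : Legal m f T B₀ s) {i : Fin n}
    (hi : i ∉ s.bad) {o : Iteration n} (ho : o ∈ s.done) : i ∉ o.bad :=
  fun h => hi ((hs.done_bad o ho).2 h)

theorem State.dev_le {B₀ : Finset (Fin n)} {s : State n} (hs : Legal m f T B₀ s) {M M' β : ℝ}
    (w : Fin n → ℝ) (hT : s.done.length = T)
    (hgood : ∀ o ∈ s.done, ∀ i, i ∉ o.bad → |walk (M - 1) (o.board.col i)| ≤ M - 1)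
    {i : Fin n} (hi : i ∉ s.bad)
    (hd : (s.done.map fun o => devPotential m (M - 1) M' i o.bad o.board).sum ≤ β) :
    s.dev w M i ≤ w i ^ 2 * (m * T + β) := by
  have h : s.dev w M i ≤
      (s.done.map fun o => w i ^ 2 * m + w i ^ 2 *
        devPotential m (M - 1) M' i o.bad o.board).sum := by
    refine List.sum_le_sum fun o ho => ?_
    have hio := hs.notMem_bad hi ho
    rw [o.X_eq_walk (hgood o ho i hio), devPotential, if_neg hio, mul_pow, ← mul_add]
    refine mul_le_mul_of_nonneg_left ?_ (sq_nonneg _)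
    have : ((min (o.board.col i).length m : ℕ) : ℝ) ≤ m := by exact_mod_cast min_le_right _ _
    linarith
  rw [list_sum_map_affine, hT] at h
  linarith [mul_le_mul_of_nonneg_left hd (sq_nonneg (w i))]

theorem State.corr_le {B₀ : Finset (Fin n)} {s : State n} (hs : Legal m f T B₀ s) {M M' β : ℝ}
    {w : Fin n → ℝ} (hw : ∀ i, 0 ≤ w i ∧ w i ≤ 1)
    (hgood : ∀ o ∈ s.done, ∀ i, i ∉ o.bad → |walk (M - 1) (o.board.col i)| ≤ M - 1)
    {i j : Fin n} (hi : i ∉ s.bad) (hj : j ∉ s.bad)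
    (hd : (s.done.map fun o => corrPotential (M - 1) M' i j o.bad o.board).sum ≤ β) :
    s.corr w M i j ≤ w i * w j * β := by
  have h : s.corr w M i j ≤
      (s.done.map fun o => 0 + w i * w j *
        corrPotential (M - 1) M' i j o.bad o.board).sum := by
    refine List.sum_le_sum fun o ho => ?_
    have hio := hs.notMem_bad hi ho
    have hjo := hs.notMem_bad hj ho
    rw [o.X_eq_walk (hgood o ho i hio), o.X_eq_walk (hgood o ho j hjo), corrPotential,
      if_neg (by tauto)]
    apply le_of_eq
    ring
  rw [list_sum_map_affine] at h
  linarith [mul_le_mul_of_nonneg_left hd (mul_nonneg (hw i).1 (hw j).1)]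

/-- The number of fine steps per unit of variance. -/
noncomputable def fineness (ε : ℝ) : ℕ := ⌈100 / ε⌉₊

/-- The number of fine steps that represent a complete blackboard. -/
noncomputable def horizon (ε : ℝ) (m f : ℕ) (w : Fin n → ℝ) (B₀ : Finset (Fin n)) : ℕ :=
  ⌊(m : ℝ) * (fineness ε * (n - f - B₀.card - 2 * ∑ i ∈ B₀ᶜ, (1 - w i)) - n)⌋₊

/-- The potential `gapPotential` with its parameters. -/
noncomputable def scorePotential (c ε : ℝ) (m f : ℕ) (w : Fin n → ℝ) (B₀ B : Finset (Fin n))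
    (b : Board n) : ℝ :=
  gapPotential m w (fun i => ⌊w i ^ 2 * fineness ε⌋₊) (Xmax c n m - 1)
    (2 * n ^ 2 * (c * Real.log n * m)) √(1 / fineness ε) (100 / ε) (horizon ε m f w B₀) B₀ B b

theorem fineness_pos (P : Params c n f m T ε) : (0 : ℝ) < fineness ε := by
  have h : 100 / ε ≤ fineness ε := Nat.le_ceil _
  have : 0 < 100 / ε := div_pos (by norm_num) P.pos
  linarith

theorem horizon_le (P : Params c n f m T ε) {w : Fin n → ℝ} (hw : ∀ i, 0 ≤ w i ∧ w i ≤ 1)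
    (B₀ : Finset (Fin n)) : (horizon ε m f w B₀ : ℝ) * √(1 / fineness ε) ^ 2 ≤ n * m := by
  have hr := fineness_pos P
  rw [Real.sq_sqrt (by positivity), mul_one_div, div_le_iff₀ hr]
  have h : horizon ε m f w B₀ ≤ n * m * fineness ε := by
    refine Nat.floor_le_of_le ?_
    push_cast
    have h1 : 0 ≤ ∑ i ∈ B₀ᶜ, (1 - w i) := Finset.sum_nonneg fun i _ => by linarith [(hw i).2]
    have h2 : (0 : ℝ) ≤ B₀.card := by positivity
    have h3 : (0 : ℝ) ≤ f := by positivity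
    have h4 : (0 : ℝ) ≤ n := by positivity
    have h5 : (fineness ε : ℝ) * (n - f - B₀.card - 2 * ∑ i ∈ B₀ᶜ, (1 - w i)) ≤ fineness ε * n :=
      mul_le_mul_of_nonneg_left (by linarith) hr.le
    have h6 := mul_le_mul_of_nonneg_left
      (show (fineness ε : ℝ) * (n - f - B₀.card - 2 * ∑ i ∈ B₀ᶜ, (1 - w i)) - n ≤
        fineness ε * n by linarith) (show (0 : ℝ) ≤ m by positivity)
    linarith
  exact_mod_cast h

/-- The squared range `(n * Xmax) ^ 2` of the good sum dominates; all other terms together are at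
most as large again, whence the factor `2`. -/
theorem scorePotential_bound (P : Params c n f m T ε) {w : Fin n → ℝ}
    (hw : ∀ i, 0 ≤ w i ∧ w i ≤ 1) (B₀ : Finset (Fin n)) :
    (n * (Xmax c n m - 1 + 1)) ^ 2 + horizon ε m f w B₀ * √(1 / fineness ε) ^ 2 +
      (100 / ε) ^ 2 / 3 + n * m / (100 / ε) ≤ 2 * n ^ 2 * (c * Real.log n * m) := by
  have hn : (3 : ℝ) ≤ n := by exact_mod_cast P.three_le
  have hm := P.million_le_m
  have h1 := horizon_le P hw B₀
  have h2 : (100 / ε) ^ 2 / 3 ≤ m := by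
    rw [div_pow, div_div, div_le_iff₀ (by have := P.pos; positivity)]
    linarith [P.le_m'']
  have h3 : n * m / (100 / ε) ≤ n * m := by
    refine div_le_self (by positivity) ?_
    rw [one_le_div P.pos]
    linarith [P.le_half]
  rw [sub_add_cancel, mul_pow, P.Xmax_sq]
  have h4 : (m : ℝ) ≤ n * m := by nlinarith
  have h5 : 3 * (n * m) ≤ n ^ 2 * (c * Real.log n * m) := by
    have h6 : 3 ≤ n * (c * Real.log n) := by nlinarith [P.le_mul_log]
    have := mul_le_mul_of_nonneg_right h6 (show (0 : ℝ) ≤ n * m by positivity)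
    linarith
  linarith

/-- The threshold for the sum of `scorePotential`. -/
noncomputable def scoreThreshold (c : ℝ) (n m T : ℕ) : ℝ :=
  2 * n ^ 2 * (c * Real.log n * m) * (√T * √(c * Real.log n))

theorem scoreThreshold_nonneg (P : Params c n f m T ε) : 0 ≤ scoreThreshold c n m T := by
  have := P.le_mul_log
  have : 0 ≤ c * Real.log n * m := by positivity
  unfold scoreThreshold
  positivity

/-- This requirement dictates the size of `T`: Azuma fluctuations of order `n ^ 2 * betaT` must be
small against a gain of order `ε * m * f` in each iteration. -/
theorem scoreThreshold_le (P : Params c n f m T ε) :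
    100 * scoreThreshold c n m T ≤ T * (m * ε * f) := by
  have e : scoreThreshold c n m T = 2 * n ^ 2 * betaT c n m T := by
    rw [P.betaT_eq', scoreThreshold]
    ring
  have h := mul_le_mul_of_nonneg_right P.betaT_le (show (0 : ℝ) ≤ n / 5 by positivity)
  have hn : (n : ℝ) / 5 ≤ f := by
    have hf : (0 : ℝ) ≤ f := by positivity
    have := mul_le_mul_of_nonneg_right P.le_half hf
    linarith [P.eq]
  have h2 := mul_le_mul_of_nonneg_left hn
    (show (0 : ℝ) ≤ m * T * ε by have := P.pos; positivity)
  rw [e]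
  linarith

theorem le_excess (P : Params c n f m T ε) {w : Fin n → ℝ} (hw : ∀ i, 0 ≤ w i ∧ w i ≤ 1)
    {B₀ : Finset (Fin n)} (hB₀ : B₀.card ≤ f) {s : State n} (hs : Legal m f T B₀ s)
    (hsurv : s.Survived T w (Xmax c n m)) (hbad : s.bad = B₀)
    (hgood : ∀ o ∈ s.done, ∀ i, i ∉ o.bad →
      |walk (Xmax c n m - 1) (o.board.col i)| ≤ Xmax c n m - 1)
    (hinv : WeightInvariant ε f w B₀)
    (hd : (s.done.map fun o => scorePotential c ε m f w B₀ o.bad o.board).sum ≤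
      scoreThreshold c n m T) :
    ε / 16 * f * alphaT c n m T ≤
      s.excess w (Xmax c n m) (alphaT c n m T) (betaT c n m T) := by
  have hr := fineness_pos P
  have hε := P.pos
  have hf1 : (1 : ℝ) ≤ f := by exact_mod_cast P.one_le_f
  have hη : √(1 / (fineness ε : ℝ)) ^ 2 = 1 / fineness ε := Real.sq_sqrt (by positivity)
  obtain ⟨x, hx⟩ : ∃ x : ℝ, x = (m : ℝ) *
    (fineness ε * (n - f - B₀.card - 2 * ∑ i ∈ B₀ᶜ, (1 - w i)) - n) := ⟨_, rfl⟩
  have hα : alphaT c n m T = m * T + betaT c n m T := by rw [alphaT, betaT, mul_add]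
  have hK1 : x - 1 ≤ (horizon ε m f w B₀ : ℝ) := by
    rw [horizon, ← hx]
    linarith [Nat.lt_floor_add_one x]
  have hup := State.sum_sq_bad_le hw (Xmax c n m) (α := alphaT c n m T) (β := betaT c n m T)
    (by rw [hα]; have := betaT_nonneg (c := c) (n := n) (m := m) (T := T); positivity)
    betaT_nonneg s (hbad ▸ hB₀)
  have hQr : (horizon ε m f w B₀ : ℝ) * √(1 / fineness ε) ^ 2 * fineness ε =
      horizon ε m f w B₀ := by
    rw [hη]
    field_simp
  have hwB : ∑ i ∈ B₀, w i = B₀.card - ∑ i ∈ B₀, (1 - w i) := by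
    rw [Finset.sum_sub_distrib]
    simp
  have hdB : 0 ≤ ∑ i ∈ B₀, (1 - w i) := Finset.sum_nonneg fun i _ => by linarith [(hw i).2]
  have harith := gap_arithmetic (n := n) (f := f) (m := m) (T := T) (b := B₀.card)
    (dB := ∑ i ∈ B₀, (1 - w i)) (dG := ∑ i ∈ B₀ᶜ, (1 - w i)) (ε := ε) (r := fineness ε)
    (Q := horizon ε m f w B₀ * √(1 / fineness ε) ^ 2) (β := betaT c n m T)
    (d := scoreThreshold c n m T) hf1 P.eq hε P.le_half P.one_le_mul_f P.le_m' (by positivity)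
    (by exact_mod_cast hB₀) hdB hinv
    (by rw [← div_le_iff₀ hε]; exact Nat.le_ceil _) (by rw [hQr, ← hx]; exact hK1)
    (horizon_le P hw B₀) betaT_nonneg P.betaT_le (scoreThreshold_nonneg P) (scoreThreshold_le P)
  have hlow := State.sum_sq_bad_ge hw hs (show 0 < 100 / ε by positivity) hsurv hbad hgood
    (show 0 < ε / 50 by positivity) (by linarith [P.le_half]) rfl hd
  rw [hbad, hwB] at hup
  rw [hbad] at hlow
  change _ * ((1 - ε / 50) * ((horizon ε m f w B₀ : ℝ) * _ / 2 - _ - _) - _) - _ ≤ _ at hlow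
  rw [hα] at hup ⊢
  linarith

theorem prob_score_le (P : Params c n f m T ε) {w : Fin n → ℝ}
    (hw : ∀ i, 0 ≤ w i ∧ w i ≤ 1) (B₀ : Finset (Fin n)) (adv : Adversary n) (N : ℕ) :
    (play m f T B₀ adv N).toOuterMeasure {h | h.1.done.length = T ∧ h.1.current = none ∧
        scoreThreshold c n m T ≤
          (h.1.done.map fun o => scorePotential c ε m f w B₀ o.bad o.board).sum} ≤
      ENNReal.ofReal (Real.exp (-(c * Real.log n / 4))) := by
  have hr := fineness_pos P
  have hn : (0 : ℝ) < n := by have := P.three_le; positivity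
  have hm : (0 : ℝ) < m := by linarith [P.million_le_m]
  have hcl : 0 < c * Real.log n := by linarith [P.le_mul_log]
  refine (prob_gap_le hw (by linarith [P.four_le_Xmax]) (div_pos (by norm_num) P.pos)
    (fun i => ?_) (scorePotential_bound P hw B₀) B₀ adv N (scoreThreshold_nonneg P)
    P.T_pos).trans (ENNReal.ofReal_le_ofReal (P.exp_tail (by positivity) rfl))
  rw [Real.sq_sqrt (by positivity), mul_one_div, div_le_iff₀ hr]
  exact Nat.floor_le (by positivity)

/-- The exceptional event: a column sum or a sum of potentials is too large. -/
def exceptional (c ε : ℝ) (m f T : ℕ) (w : Fin n → ℝ) (B₀ : Finset (Fin n)) :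
    Set (State n × List (State n)) :=
  (((⋃ i, {h | ∃ o ∈ h.1.done, i ∉ o.bad ∧
      Xmax c n m - 1 < |walk (Xmax c n m - 1) (o.board.col i)|}) ∪
    (⋃ i, {h | h.1.done.length = T ∧ h.1.current = none ∧ betaT c n m T ≤
      (h.1.done.map fun o => devPotential m (Xmax c n m - 1) (c * Real.log n * m) i
        o.bad o.board).sum})) ∪
    (⋃ i, ⋃ j, {h | i ≠ j ∧ h.1.done.length = T ∧ h.1.current = none ∧ betaT c n m T ≤
      (h.1.done.map fun o => corrPotential (Xmax c n m - 1) (c * Real.log n * m) i j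
        o.bad o.board).sum})) ∪
    {h | h.1.done.length = T ∧ h.1.current = none ∧ scoreThreshold c n m T ≤
      (h.1.done.map fun o => scorePotential c ε m f w B₀ o.bad o.board).sum}

theorem prob_exceptional_le (P : Params c n f m T ε) {w : Fin n → ℝ}
    (hw : ∀ i, 0 ≤ w i ∧ w i ≤ 1) (B₀ : Finset (Fin n)) (adv : Adversary n) (N : ℕ) :
    (play m f T B₀ adv N).toOuterMeasure (exceptional c ε m f T w B₀) ≤
      ENNReal.ofReal ((n : ℝ) ^ (-(1 / 8 * c))) := by
  obtain ⟨x, hx⟩ : ∃ x, x = Real.exp (-(c * Real.log n / 4)) := ⟨_, rfl⟩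
  have hx0 : 0 ≤ x := hx ▸ (Real.exp_pos _).le
  have hL : 0 ≤ Xmax c n m - 1 := by linarith [P.four_le_Xmax]
  have hm : (0 : ℝ) < m := by linarith [P.million_le_m]
  have hcl : 0 < c * Real.log n := by linarith [P.le_mul_log]
  have hM : (Xmax c n m - 1 + 1) ^ 2 ≤ c * Real.log n * m := by rw [sub_add_cancel, P.Xmax_sq]
  have hmM : (m : ℝ) ≤ c * Real.log n * m :=
    le_mul_of_one_le_left hm.le (by linarith [P.le_mul_log])
  have htail := P.exp_tail (by positivity) P.betaT_eq'
  have h1 := measure_iUnion_fin_le (play m f T B₀ adv N)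
    (fun i => {h | ∃ o ∈ h.1.done, i ∉ o.bad ∧
      Xmax c n m - 1 < |walk (Xmax c n m - 1) (o.board.col i)|}) (x := T * (2 * x)) fun i =>
    (prob_overflow_le (by exact_mod_cast hm) hL i B₀ adv N).trans (ENNReal.ofReal_le_ofReal
      (mul_le_mul_of_nonneg_left (by rw [hx]; linarith [P.overflow_tail]) (by positivity)))
  have h2 := measure_iUnion_fin_le (play m f T B₀ adv N)
    (fun i => {h | h.1.done.length = T ∧ h.1.current = none ∧ betaT c n m T ≤
      (h.1.done.map fun o => devPotential m (Xmax c n m - 1) (c * Real.log n * m) i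
        o.bad o.board).sum}) (x := x) fun i =>
    (prob_dev_le hL hmM hM i B₀ adv N betaT_nonneg P.T_pos).trans
      (ENNReal.ofReal_le_ofReal (hx ▸ htail))
  have h3 := measure_iUnion_fin_le (play m f T B₀ adv N)
    (fun i => ⋃ j, {h | i ≠ j ∧ h.1.done.length = T ∧ h.1.current = none ∧ betaT c n m T ≤
      (h.1.done.map fun o => corrPotential (Xmax c n m - 1) (c * Real.log n * m) i j
        o.bad o.board).sum}) (x := n * x) fun i =>
    measure_iUnion_fin_le (play m f T B₀ adv N) _ fun j => by
      by_cases hij : i = j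
      · simp [hij]
      · refine le_trans (MeasureTheory.measure_mono fun h hh => hh.2)
          ((prob_corr_le hL hM hij B₀ adv N betaT_nonneg P.T_pos).trans
            (ENNReal.ofReal_le_ofReal (hx ▸ htail)))
  have h4 := prob_score_le P hw B₀ adv N
  rw [← hx] at h4
  have hu := P.union_bound
  rw [← hx] at hu
  refine le_trans ?_ (ENNReal.ofReal_le_ofReal hu)
  have e : (2 * n * T + n + n ^ 2 + 1 : ℝ) * x =
      ((n * (T * (2 * x)) + n * x) + n * (n * x)) + x := by ring
  rw [e, ENNReal.ofReal_add (by positivity) hx0, ENNReal.ofReal_add (by positivity) (by positivity),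
    ENNReal.ofReal_add (by positivity) (by positivity)]
  refine (MeasureTheory.measure_union_le _ _).trans (add_le_add ?_ h4)
  refine (MeasureTheory.measure_union_le _ _).trans (add_le_add ?_ h3)
  exact (MeasureTheory.measure_union_le _ _).trans (add_le_add h1 h2)

theorem scores_of_notMem_exceptional (P : Params c n f m T ε) {w : Fin n → ℝ}
    (hw : ∀ i, 0 ≤ w i ∧ w i ≤ 1) {B₀ : Finset (Fin n)} (hB₀ : B₀.card ≤ f)
    {h : State n × List (State n)} (hs : Legal m f T B₀ h.1)
    (hh : h ∉ exceptional c ε m f T w B₀) (hsurv : h.1.Survived T w (Xmax c n m)) :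
    (∀ i, i ∉ h.1.bad → h.1.dev w (Xmax c n m) i ≤ w i ^ 2 * alphaT c n m T) ∧
      (∀ i j, i ∉ h.1.bad → j ∉ h.1.bad → i ≠ j →
        h.1.corr w (Xmax c n m) i j ≤ w i * w j * betaT c n m T) ∧
      (WeightInvariant ε f w h.1.bad → h.1.bad = B₀ →
        ε / 16 * f * alphaT c n m T ≤
          h.1.excess w (Xmax c n m) (alphaT c n m T) (betaT c n m T)) := by
  simp only [exceptional, Set.mem_union, Set.mem_iUnion, Set.mem_ofPred_eq, not_or, not_exists,
    not_and, not_le, not_lt] at hh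
  obtain ⟨⟨⟨h1, h2⟩, h3⟩, h4⟩ := hh
  have hT := hsurv.1
  -- An open board would mean that fewer than `T` iterations are completed.
  have hcur : h.1.current = none := by
    by_contra hc
    obtain ⟨b, hb⟩ := Option.ne_none_iff_exists'.1 hc
    exact absurd hT (hs.current_lt b hb).ne
  have hgood : ∀ o ∈ h.1.done, ∀ i, i ∉ o.bad →
      |walk (Xmax c n m - 1) (o.board.col i)| ≤ Xmax c n m - 1 := fun o ho i hi => h1 i o ho hi
  refine ⟨fun i hi => ?_, fun i j hi hj hij => ?_, fun hinv hbad => ?_⟩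
  · rw [alphaT, mul_add]
    exact State.dev_le hs w hT hgood hi (h2 i hT hcur).le
  · exact State.corr_le hs hw hgood hi hj (h3 i j hij hT hcur).le
  · exact le_excess P hw hB₀ hs hsurv hbad hgood (hbad ▸ hinv) (h4 hT hcur).le

end CoinGame

theorem mainTheorem3 :
    ∃ κ c₀ A : ℝ, 0 < κ ∧ 0 < c₀ ∧ 0 < A ∧
    ∀ c : ℝ, c₀ ≤ c →
    ∃ D : ℝ, 0 < D ∧
    ∀ A' D' : ℝ, ∃ n₀ : ℕ,
    ∀ (n f m T : ℕ) (ε : ℝ), n₀ ≤ n → 0 < ε → ε ≤ 1 / 2 → (n : ℝ) = (4 + ε) * f →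
    A * (n / ε ^ 2) ≤ m → m ≤ A' * (n / ε ^ 2) →
    D * (n ^ 2 * Real.log n ^ 3 / ε ^ 2) ≤ T → T ≤ D' * (n ^ 2 * Real.log n ^ 3 / ε ^ 2) →
    ∀ (w : Fin n → ℝ), (∀ i, 0 ≤ w i ∧ w i ≤ 1) →
    ∀ (B₀ : Finset (Fin n)), B₀.card ≤ f →
    ∀ (adv : Adversary n) (N : ℕ),
      1 - (n : ℝ) ^ (-(κ * c)) ≤
        ((play m f T B₀ adv N).toOuterMeasure
          {h | h.1.Survived T w (Xmax c n m) →
            (∀ i, i ∉ h.1.bad → h.1.dev w (Xmax c n m) i ≤ w i ^ 2 * alphaT c n m T) ∧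
            (∀ i j, i ∉ h.1.bad → j ∉ h.1.bad → i ≠ j →
              h.1.corr w (Xmax c n m) i j ≤ w i * w j * betaT c n m T) ∧
            (WeightInvariant ε f w h.1.bad → h.1.bad = B₀ →
              ε / 16 * f * alphaT c n m T ≤
                h.1.excess w (Xmax c n m) (alphaT c n m T) (betaT c n m T))}).toReal := by
  -- The bound `n₀ ≥ D'` lets `n` replace the constant `D'`, so `T` is polynomial in `n`.
  refine ⟨1 / 8, 80, 1000000, by norm_num, by norm_num, by norm_num, fun c hc =>
    ⟨1000000 * c ^ 3, by positivity, fun _ D' => ⟨max 3 ⌈D'⌉₊, ?_⟩⟩⟩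
  intro n f m T ε hn hε hε1 hnf hm _ hT hT' w hw B₀ hB₀ adv N
  have hn3 : 3 ≤ n := (le_max_left _ _).trans hn
  have hD' : D' ≤ n := Nat.ceil_le.1 ((le_max_right _ _).trans hn)
  have P : Params c n f m T ε := by
    refine ⟨hn3, hc, hε, hε1, hnf, hm, hT, hT'.trans (mul_le_mul_of_nonneg_right hD' ?_)⟩
    have : 0 ≤ Real.log n := Real.log_natCast_nonneg n
    positivity
  refine one_sub_le_toReal_toOuterMeasure _ _ ?_ (by positivity)
  -- The inclusion is needed only on the support, where positions are legal.
  refine le_trans (PMF.toOuterMeasure_mono _ ?_) (prob_exceptional_le P hw B₀ adv N)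
  rintro h ⟨hh, hsupp⟩
  by_contra hex
  exact hh (scores_of_notMem_exceptional P hw hB₀ (legal_of_mem_support_play hsupp) hex)
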